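/- Let $\mathbb{T}=\mathbb{R}/2\pi\mathbb{Z}$, $\alpha\in(0,1)$, and let $F\in C^4(\mathbb{R};\mathbb{R})$ satisfy $F'(s)>-\lambda_1$ for all $s\in\mathbb{R}$, where $\lambda_1$ is the first eigenvalue of the Dirichlet Laplacian $-\Delta$ in $\mathbb{T}\times(-1,1)$. Let $c_h\neq c_g$ be real numbers and let $\psi_0\in C^2(\mathbb{T}\times[-1,1])$ satisfy $$\Delta\psi_0=F(\psi_0)\ \text{ in }\mathbb{T}\times(-1,1),\qquad \psi_0(x,1)=c_h,\quad \psi_0(x,-1)=c_g\quad\text{for } x\in\mathbb{T}.$$ Assume that $\nabla\psi_0(x_0,y_0)=0$ for some $x_0\in\mathbb{T}$ and $y_0\in(-1,1)$. Equip $C^{2,\alpha}(\mathbb{T})$ with the norm $\|u\|_\infty+\|u'\|_\infty+\|u''\|_\infty+[u'']_\alpha$, where $[v]_\alpha=\sup_{s\ne t}|v(s)-v(t)|/|s-t|^\alpha$. Then there exists an open and dense set $\mathcal{B}\subset (C^{2,\alpha}(\mathbb{T}))^2$ such that for all $(g,h)\in\mathcal{B}$ the linearized problem $$\begin{cases}(\Delta-F'(\psi_0))\varphi=0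 & \text{in }\mathbb{T}\times(-1,1),\\ \varphi(x,1)=-h(x)\,\partial_y\psi_0(x,1) & \text{for }x\in\mathbb{T},\\ \varphi(x,-1)=g(x)\,\partial_y\psi_0(x,-1) & \text{for }x\in\mathbb{T}\end{cases}$$ has a unique classical solution $\varphi\in C^2(\mathbb{T}\times(-1,1))\cap C^0(\mathbb{T}\times[-1,1])$, and the function $x\mapsto\varphi(x,y_0)$ is non-constant. -/

import Mathlib

open scoped NNReal

noncomputable section

/-! The circle `𝕋 = ℝ / 2πℤ` is represented by `2π`-periodic functions on `ℝ`.
Functions on the channel `𝕋 × [-1, 1]` are functions `u : ℝ → ℝ → ℝ`, `(x, y) ↦ u x y`, that are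
`2π`-periodic in `x`; only their values for `y ∈ [-1, 1]` matter. -/

/-- The vector space underlying `C^{2,α}(𝕋)`: the `2π`-periodic `C²` functions whose second
derivative is `α`-Hölder continuous. -/
def periodicC2HolderSubmodule (α : ℝ≥0) : Submodule ℝ (ℝ → ℝ) where
  carrier := {u | Function.Periodic u (2 * Real.pi) ∧ ContDiff ℝ 2 u ∧
    MemHolder α (iteratedDeriv 2 u)}
  add_mem' := by
    rintro u v ⟨hu, hu', hu''⟩ ⟨hv, hv', hv''⟩
    refine ⟨hu.add hv, hu'.add hv', ?_⟩
    have : iteratedDeriv 2 (u + v) = iteratedDeriv 2 u + iteratedDeriv 2 v := by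
      funext x
      exact iteratedDeriv_add hu'.contDiffAt hv'.contDiffAt
    rw [this]
    exact hu''.add hv''
  zero_mem' := by
    refine ⟨fun x => rfl, contDiff_const, ?_⟩
    have : iteratedDeriv 2 (0 : ℝ → ℝ) = fun _ => 0 := by
      funext x
      simp [Pi.zero_def]
    rw [this]
    exact memHolder_const'
  smul_mem' := by
    rintro c u ⟨hu, hu', hu''⟩
    refine ⟨hu.smul c, contDiff_const.smul hu', ?_⟩
    have : iteratedDeriv 2 (c • u) = c • iteratedDeriv 2 u := by
      funext x
      exact iteratedDeriv_const_smul hu'.contDiffAt c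
    rw [this]
    exact hu''.smul

/-- The Hölder space `C^{2,α}(𝕋)`. It is a type of its own, so that it carries the Hölder norm
topology and not the topology of pointwise convergence. -/
def PeriodicC2Holder (α : ℝ≥0) : Type := periodicC2HolderSubmodule α

namespace PeriodicC2Holder

variable {α : ℝ≥0}

instance : AddCommGroup (PeriodicC2Holder α) :=
  inferInstanceAs (AddCommGroup (periodicC2HolderSubmodule α))

instance : Module ℝ (PeriodicC2Holder α) :=
  inferInstanceAs (Module ℝ (periodicC2HolderSubmodule α))

/-- The underlying function of an element of `C^{2,α}(𝕋)`. -/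
def toFun (u : PeriodicC2Holder α) : ℝ → ℝ := u.1

instance : CoeFun (PeriodicC2Holder α) (fun _ => ℝ → ℝ) := ⟨toFun⟩

theorem periodic (u : PeriodicC2Holder α) : Function.Periodic u (2 * Real.pi) := u.2.1

theorem contDiff (u : PeriodicC2Holder α) : ContDiff ℝ 2 u := u.2.2.1

theorem memHolder (u : PeriodicC2Holder α) : MemHolder α (iteratedDeriv 2 u) := u.2.2.2

/-- The norm `‖u‖_∞ + ‖u'‖_∞ + ‖u''‖_∞ + [u'']_α` of `C^{2,α}(𝕋)`. -/
instance : Norm (PeriodicC2Holder α) :=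
  ⟨fun u => (∑ i ∈ Finset.range 3, ⨆ x : ℝ, |iteratedDeriv i u x|) +
    (nnHolderNorm α (iteratedDeriv 2 u) : ℝ)⟩

theorem norm_def (u : PeriodicC2Holder α) :
    ‖u‖ = (∑ i ∈ Finset.range 3, ⨆ x : ℝ, |iteratedDeriv i u x|) +
      (nnHolderNorm α (iteratedDeriv 2 u) : ℝ) := rfl

theorem periodic_iteratedDeriv (u : PeriodicC2Holder α) (i : ℕ) :
    Function.Periodic (iteratedDeriv i u) (2 * Real.pi) := by
  intro x
  have h : (fun z => u (z + 2 * Real.pi)) = u := funext u.periodic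
  have h2 := congrFun (iteratedDeriv_comp_add_const i u (2 * Real.pi)) x
  rw [h] at h2
  exact h2.symm

theorem bddAbove_range (u : PeriodicC2Holder α) {i : ℕ} (hi : i ∈ Finset.range 3) :
    BddAbove (Set.range fun x : ℝ => |iteratedDeriv i u x|) := by
  have hi' : i ≤ 2 := by
    have := Finset.mem_range.1 hi
    omega
  have hc : Continuous (iteratedDeriv i u) :=
    u.contDiff.continuous_iteratedDeriv i (by exact_mod_cast hi')
  have hp : Function.Periodic (fun x : ℝ => |iteratedDeriv i u x|) (2 * Real.pi) := by
    intro x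
    simp only [u.periodic_iteratedDeriv i x]
  exact (hp.compact_of_continuous Real.two_pi_pos.ne' hc.abs).bddAbove

theorem iteratedDeriv_add' (u v : PeriodicC2Holder α) {i : ℕ} (hi : i ∈ Finset.range 3) :
    iteratedDeriv i (u + v : PeriodicC2Holder α) = iteratedDeriv i u + iteratedDeriv i v := by
  have hi' : i ≤ 2 := by
    have := Finset.mem_range.1 hi
    omega
  funext x
  exact iteratedDeriv_add ((u.contDiff.of_le (by exact_mod_cast hi')).contDiffAt)
    ((v.contDiff.of_le (by exact_mod_cast hi')).contDiffAt)

theorem iteratedDeriv_smul' (c : ℝ) (u : PeriodicC2Holder α) {i : ℕ}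
    (hi : i ∈ Finset.range 3) :
    iteratedDeriv i (c • u : PeriodicC2Holder α) = c • iteratedDeriv i u := by
  have hi' : i ≤ 2 := by
    have := Finset.mem_range.1 hi
    omega
  funext x
  exact iteratedDeriv_const_smul ((u.contDiff.of_le (by exact_mod_cast hi')).contDiffAt) c

theorem normedSpaceCore : NormedSpace.Core ℝ (PeriodicC2Holder α) where
  norm_nonneg u := by
    rw [norm_def]
    exact add_nonneg (Finset.sum_nonneg fun i _ => Real.iSup_nonneg fun x => abs_nonneg _)
      (NNReal.coe_nonneg _)
  norm_smul c u := by
    rw [norm_def, norm_def, mul_add, Finset.mul_sum]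
    congr 1
    · refine Finset.sum_congr rfl fun i hi => ?_
      rw [iteratedDeriv_smul' c u hi, Real.norm_eq_abs, Real.mul_iSup_of_nonneg (abs_nonneg c)]
      simp [abs_mul]
    · rw [iteratedDeriv_smul' c u (by simp), u.memHolder.nnHolderNorm_smul c]
      simp
  norm_triangle u v := by
    rw [norm_def, norm_def, norm_def]
    have h1 : ∑ i ∈ Finset.range 3, ⨆ x : ℝ, |iteratedDeriv i (u + v : PeriodicC2Holder α) x| ≤
        (∑ i ∈ Finset.range 3, ⨆ x : ℝ, |iteratedDeriv i u x|) +
          ∑ i ∈ Finset.range 3, ⨆ x : ℝ, |iteratedDeriv i v x| := by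
      rw [← Finset.sum_add_distrib]
      refine Finset.sum_le_sum fun i hi => ?_
      rw [iteratedDeriv_add' u v hi]
      refine ciSup_le fun x => (abs_add_le _ _).trans ?_
      exact add_le_add (le_ciSup (u.bddAbove_range hi) x) (le_ciSup (v.bddAbove_range hi) x)
    have h2 : (nnHolderNorm α (iteratedDeriv 2 (u + v : PeriodicC2Holder α)) : ℝ) ≤
        nnHolderNorm α (iteratedDeriv 2 u) + nnHolderNorm α (iteratedDeriv 2 v) := by
      rw [iteratedDeriv_add' u v (by simp)]
      exact_mod_cast u.memHolder.nnHolderNorm_add_le v.memHolder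
    linarith
  norm_eq_zero_iff u := by
    constructor
    · intro h
      rw [norm_def] at h
      have h0 : ∀ i ∈ Finset.range 3, 0 ≤ ⨆ x : ℝ, |iteratedDeriv i u x| :=
        fun i _ => Real.iSup_nonneg fun x => abs_nonneg _
      have hs := Finset.sum_nonneg h0
      have hn : (0 : ℝ) ≤ nnHolderNorm α (iteratedDeriv 2 u) := NNReal.coe_nonneg _
      have hz : ∑ i ∈ Finset.range 3, ⨆ x : ℝ, |iteratedDeriv i u x| = 0 := by linarith
      have hz0 := (Finset.sum_eq_zero_iff_of_nonneg h0).1 hz 0 (by simp)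
      refine Subtype.ext (funext fun x => ?_)
      have hx := le_ciSup (u.bddAbove_range (i := 0) (by simp)) x
      rw [hz0] at hx
      have hx' : |u.toFun x| ≤ 0 := by
        simpa only [iteratedDeriv_zero] using hx
      exact abs_nonpos_iff.1 hx'
    · rintro rfl
      have h : ∀ i ∈ Finset.range 3, iteratedDeriv i (0 : PeriodicC2Holder α) = 0 := by
        intro i hi
        have := iteratedDeriv_smul' 0 (0 : PeriodicC2Holder α) hi
        simpa using this
      rw [norm_def, h 2 (by simp), nnHolderNorm_zero, Finset.sum_eq_zero]
      · simp
      · intro i hi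
        rw [h i hi]
        simp

instance : NormedAddCommGroup (PeriodicC2Holder α) := NormedAddCommGroup.ofCore normedSpaceCore

instance : NormedSpace ℝ (PeriodicC2Holder α) := NormedSpace.ofCore normedSpaceCore

end PeriodicC2Holder

/-- The Laplacian `∂²u/∂x² + ∂²u/∂y²` at the point `(x, y)`. -/
def channelLaplacian (u : ℝ → ℝ → ℝ) (x y : ℝ) : ℝ :=
  iteratedDeriv 2 (fun s => u s y) x + iteratedDeriv 2 (fun t => u x t) y

/-- A function on the closed channel `𝕋 × [-1, 1]`: periodicity in the horizontal variable. -/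
def PeriodicOnChannel (u : ℝ → ℝ → ℝ) : Prop :=
  ∀ x : ℝ, ∀ y ∈ Set.Icc (-1 : ℝ) 1, u (x + 2 * Real.pi) y = u x y

/-- The regularity of a classical solution of a Dirichlet problem in the channel:
`u ∈ C²(𝕋 × (-1, 1)) ∩ C⁰(𝕋 × [-1, 1])`. -/
structure IsClassicalOnChannel (u : ℝ → ℝ → ℝ) : Prop where
  periodic : PeriodicOnChannel u
  contDiffOn : ContDiffOn ℝ 2 (Function.uncurry u) (Set.univ ×ˢ Set.Ioo (-1 : ℝ) 1)
  continuousOn : ContinuousOn (Function.uncurry u) (Set.univ ×ˢ Set.Icc (-1 : ℝ) 1)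

/-- `μ` is an eigenvalue of the Dirichlet Laplacian `-Δ` in `𝕋 × (-1, 1)`. -/
def IsDirichletEigenvalue (μ : ℝ) : Prop :=
  ∃ u : ℝ → ℝ → ℝ, IsClassicalOnChannel u ∧
    (∀ x : ℝ, ∀ y ∈ Set.Ioo (-1 : ℝ) 1, -channelLaplacian u x y = μ * u x y) ∧
    (∀ x : ℝ, u x 1 = 0 ∧ u x (-1) = 0) ∧
    ∃ x : ℝ, ∃ y ∈ Set.Icc (-1 : ℝ) 1, u x y ≠ 0

/-- The first eigenvalue `λ₁` of the Dirichlet Laplacian in `𝕋 × (-1, 1)`. -/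
def firstDirichletEigenvalue : ℝ := sInf {μ : ℝ | IsDirichletEigenvalue μ}

/-- `ψ ∈ C²(𝕋 × [-1, 1])` (up to the boundary) is a stream function with `Δψ = F(ψ)` in the
channel, equal to `ch` on the top boundary and to `cg` on the bottom boundary. -/
structure IsSteadyStreamFunction (F : ℝ → ℝ) (cg ch : ℝ) (ψ : ℝ → ℝ → ℝ) : Prop where
  periodic : PeriodicOnChannel ψ
  contDiffOn : ContDiffOn ℝ 2 (Function.uncurry ψ) (Set.univ ×ˢ Set.Icc (-1 : ℝ) 1)
  equation : ∀ x : ℝ, ∀ y ∈ Set.Ioo (-1 : ℝ) 1, channelLaplacian ψ x y = F (ψ x y)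
  top : ∀ x : ℝ, ψ x 1 = ch
  bottom : ∀ x : ℝ, ψ x (-1) = cg

/-- The partial derivative `∂ψ/∂y` in the closed channel, one-sided at `y = ±1`. -/
def verticalDeriv (ψ : ℝ → ℝ → ℝ) (x y : ℝ) : ℝ :=
  derivWithin (fun t => ψ x t) (Set.Icc (-1 : ℝ) 1) y

/-- `∇ψ = 0` at the point `(x, y)`. -/
def IsStagnationPoint (ψ : ℝ → ℝ → ℝ) (x y : ℝ) : Prop :=
  deriv (fun s => ψ s y) x = 0 ∧ verticalDeriv ψ x y = 0

/-- `φ` is a classical solution of the linearized problem `(Δ - F'(ψ)) φ = 0` in the channel with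
`φ(x, 1) = -h(x) ∂_yψ(x, 1)` and `φ(x, -1) = g(x) ∂_yψ(x, -1)`. -/
structure IsLinearizedSolution (F : ℝ → ℝ) (ψ : ℝ → ℝ → ℝ) (g h : ℝ → ℝ)
    (φ : ℝ → ℝ → ℝ) : Prop where
  classical : IsClassicalOnChannel φ
  equation : ∀ x : ℝ, ∀ y ∈ Set.Ioo (-1 : ℝ) 1,
    channelLaplacian φ x y - deriv F (ψ x y) * φ x y = 0
  top : ∀ x : ℝ, φ x 1 = -h x * verticalDeriv ψ x 1
  bottom : ∀ x : ℝ, φ x (-1) = g x * verticalDeriv ψ x (-1)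

end

/-! The function `cos (π y / 2)` is a Dirichlet eigenfunction with eigenvalue `π² / 4`, so `F' > -π²
/ 4`. By compactness `F' > -κ²` on the range of `ψ₀` for some `0 ≤ κ < π / 2`. Then `cos (κ y)` is
positive on the closed channel and is a strict supersolution of `Δ - F'(ψ₀)`, and this yields the
maximum principle that governs the whole argument: uniqueness, comparison and a sup bound by the
boundary values (`nonneg_of_laplacian_lt`, `IsClassicalOnChannel.eq_zero`,
`IsClassicalOnChannel.abs_le_of_boundary`).

Applied to the difference of `ψ₀` and a horizontal translate, it shows that `ψ₀` depends on `y`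
only. The linearized operator is therefore `Δ - q(y)` with `q = F'(ψ₀)`, and the boundary factors
are constants `V = ψ₀'(1)` and `W = ψ₀'(-1)`. They are not both zero: `v = ψ₀'` solves `v'' = q v`,
so zero end values would force `v = 0` and equal boundary values of `ψ₀`.

Existence is by separation of variables. Periodic `C²` data have absolutely summable Fourier
coefficients, and the mode `n` is continued into the channel by the solution of `A'' = (n² + q) A`
with `A (-1) = 0`, `A 1 = 1`. For large `|n|` comparison with exponentials shows that it decays away
from the top edge fast enough to differentiate the series twice (`exists_profile_bounds`,
`exists_dirichlet_of_summable`).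

Finally `T (g, h) = φ(0, y₀) - φ(π, y₀)` is a continuous linear functional of the data. It is
nonzero: place `cos x` on an edge where `V` or `W` does not vanish; the solution is a nonzero
multiple of `A(y) cos x` with `A > 0` inside, up to reflection in `y`. The set `T ≠ 0` is the
complement of a closed proper subspace, hence open and dense, and on it `φ(·, y₀)` is not constant.
-/

/-! ### Maximum principle in the channel -/

/-- Second-order necessary condition at a local minimum. -/
theorem IsLocalMin.second_deriv_nonneg {f f' : ℝ → ℝ} {x c : ℝ} (hm : IsLocalMin f x)
    (hf : ∀ᶠ y in nhds x, HasDerivAt f (f' y) y) (hf' : HasDerivAt f' c x) : 0 ≤ c := by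
  by_contra! hc
  have hd : deriv f =ᶠ[nhds x] f' := hf.mono fun y hy => hy.deriv
  have hdd : deriv (deriv f) x = c := by rw [hd.deriv_eq, hf'.deriv]
  -- A negative second derivative makes `x` a local maximum too, so `f` is locally constant and its
  -- second derivative is zero.
  have hmax : IsLocalMax f x :=
    isLocalMax_of_deriv_deriv_neg (by rw [hdd]; exact hc) hm.deriv_eq_zero
      hf.self_of_nhds.continuousAt
  have hconst : f =ᶠ[nhds x] fun _ => f x := by
    filter_upwards [hm, hmax] with y h1 h2 using le_antisymm h2 h1
  have h0 : deriv (deriv f) x = 0 := by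
    rw [hconst.deriv.deriv_eq]
    simp
  rw [hdd] at h0
  exact hc.ne h0

theorem cos_mul_pos {κ y : ℝ} (h0 : 0 ≤ κ) (h1 : κ < Real.pi / 2) (hy : y ∈ Set.Icc (-1 : ℝ) 1) :
    0 < Real.cos (κ * y) := by
  apply Real.cos_pos_of_mem_Ioo
  constructor <;> nlinarith [hy.1, hy.2]

theorem hasDerivAt_cos_mul (κ y : ℝ) :
    HasDerivAt (fun t => Real.cos (κ * t)) (-κ * Real.sin (κ * y)) y := by
  have := (Real.hasDerivAt_cos (κ * y)).comp y ((hasDerivAt_id y).const_mul κ)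
  refine this.congr_deriv ?_
  simp
  ring

theorem hasDerivAt_neg_mul_sin_mul (κ y : ℝ) :
    HasDerivAt (fun t => -κ * Real.sin (κ * t)) (-κ ^ 2 * Real.cos (κ * y)) y := by
  have := ((Real.hasDerivAt_sin (κ * y)).comp y ((hasDerivAt_id y).const_mul κ)).const_mul (-κ)
  refine this.congr_deriv ?_
  simp
  ring

/-- Maximum principle in the channel: comparison with the positive function `cos (κ y)`. -/
theorem nonneg_of_laplacian_lt {κ : ℝ} (hκ0 : 0 ≤ κ) (hκ1 : κ < Real.pi / 2)
    {u ux uxx uy uyy : ℝ → ℝ → ℝ} (hper : PeriodicOnChannel u)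
    (hcont : ContinuousOn (Function.uncurry u) (Set.univ ×ˢ Set.Icc (-1 : ℝ) 1))
    (hx : ∀ x, ∀ y ∈ Set.Ioo (-1 : ℝ) 1, HasDerivAt (fun s => u s y) (ux x y) x)
    (hxx : ∀ x, ∀ y ∈ Set.Ioo (-1 : ℝ) 1, HasDerivAt (fun s => ux s y) (uxx x y) x)
    (hy : ∀ x, ∀ y ∈ Set.Ioo (-1 : ℝ) 1, HasDerivAt (u x) (uy x y) y)
    (hyy : ∀ x, ∀ y ∈ Set.Ioo (-1 : ℝ) 1, HasDerivAt (uy x) (uyy x y) y)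
    (htop : ∀ x, 0 ≤ u x 1) (hbot : ∀ x, 0 ≤ u x (-1))
    (hlap : ∀ x, ∀ y ∈ Set.Ioo (-1 : ℝ) 1, u x y < 0 → uxx x y + uyy x y < -κ ^ 2 * u x y) :
    ∀ x, ∀ y ∈ Set.Icc (-1 : ℝ) 1, 0 ≤ u x y := by
  set θ : ℝ → ℝ := fun y => Real.cos (κ * y) with hθ
  have hθpos : ∀ y ∈ Set.Icc (-1 : ℝ) 1, 0 < θ y := fun y hy => cos_mul_pos hκ0 hκ1 hy
  have hK : IsCompact (Set.Icc (0 : ℝ) (2 * Real.pi) ×ˢ Set.Icc (-1 : ℝ) 1) :=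
    isCompact_Icc.prod isCompact_Icc
  have hcont' : ContinuousOn (fun p : ℝ × ℝ => u p.1 p.2 / θ p.2)
      (Set.univ ×ˢ Set.Icc (-1 : ℝ) 1) := by
    refine ContinuousOn.div hcont (by fun_prop) fun p hp => (hθpos _ hp.2).ne'
  -- If the minimum `m` of `u / θ` over one period is negative, `u - m θ ≥ 0` vanishes at an
  -- interior point. The second-order conditions there give `uxx + uyy ≥ -κ² m θ = -κ² u`, against
  -- `hlap`.
  obtain ⟨⟨x₁, y₁⟩, hp₁, hmin⟩ := hK.exists_isMinOn
    ⟨(0, 0), ⟨⟨le_rfl, Real.two_pi_pos.le⟩, by norm_num⟩⟩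
    (hcont'.mono (Set.prod_mono (Set.subset_univ _) subset_rfl))
  have hy₁ : y₁ ∈ Set.Icc (-1 : ℝ) 1 := hp₁.2
  set m := u x₁ y₁ / θ y₁ with hm
  have hglob : ∀ x, ∀ y ∈ Set.Icc (-1 : ℝ) 1, m * θ y ≤ u x y := by
    intro x y hy
    have hp : Function.Periodic (fun s => u s y) (2 * Real.pi) := fun s => hper s y hy
    obtain ⟨x', hx', he⟩ := hp.exists_mem_Ico₀ Real.two_pi_pos x
    have h := hmin (a := (x', y)) ⟨Set.Ico_subset_Icc_self hx', hy⟩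
    change m ≤ u x' y / θ y at h
    have he' : u x y = u x' y := he
    rw [he']
    exact (le_div_iff₀ (hθpos y hy)).1 h
  by_cases hm0 : 0 ≤ m
  · intro x y hy
    exact (mul_nonneg hm0 (hθpos y hy).le).trans (hglob x y hy)
  push Not at hm0
  exfalso
  have hu₁ : u x₁ y₁ = m * θ y₁ := by
    rw [hm, div_mul_cancel₀ _ (hθpos y₁ hy₁).ne']
  have hneg : u x₁ y₁ < 0 := hu₁ ▸ mul_neg_of_neg_of_pos hm0 (hθpos y₁ hy₁)
  have hyo : y₁ ∈ Set.Ioo (-1 : ℝ) 1 := by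
    refine ⟨lt_of_le_of_ne hy₁.1 ?_, lt_of_le_of_ne hy₁.2 ?_⟩
    · rintro rfl
      exact absurd (hbot x₁) (not_le.2 hneg)
    · rintro rfl
      exact absurd (htop x₁) (not_le.2 hneg)
  have h1 : 0 ≤ uxx x₁ y₁ := by
    refine IsLocalMin.second_deriv_nonneg (f := fun s => u s y₁) (f' := fun s => ux s y₁) ?_
      (Filter.Eventually.of_forall fun s => hx s y₁ hyo) (hxx x₁ y₁ hyo)
    refine Filter.Eventually.of_forall fun s => ?_
    simp only [hu₁]
    exact hglob s y₁ hy₁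
  have h2 : 0 ≤ uyy x₁ y₁ - m * (-κ ^ 2 * Real.cos (κ * y₁)) := by
    have hnhds : Set.Ioo (-1 : ℝ) 1 ∈ nhds y₁ := isOpen_Ioo.mem_nhds hyo
    refine IsLocalMin.second_deriv_nonneg (x := y₁) (f := fun t => u x₁ t - m * θ t)
      (f' := fun t => uy x₁ t - m * (-κ * Real.sin (κ * t))) ?_ ?_ ?_
    · filter_upwards [hnhds] with t ht
      simp only [hu₁, sub_self]
      linarith [hglob x₁ t (Set.Ioo_subset_Icc_self ht)]
    · filter_upwards [hnhds] with t ht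
      exact (hy x₁ t ht).sub ((hasDerivAt_cos_mul κ t).const_mul m)
    · exact (hyy x₁ y₁ hyo).sub ((hasDerivAt_neg_mul_sin_mul κ y₁).const_mul m)
  have h3 := hlap x₁ y₁ hyo hneg
  rw [hu₁] at h3
  simp only [hθ] at h3
  linarith

/-- One-dimensional maximum principle. -/
theorem nonneg_of_second_deriv_lt {κ : ℝ} (hκ0 : 0 ≤ κ) (hκ1 : κ < Real.pi / 2)
    {f f' f'' : ℝ → ℝ} (hcont : ContinuousOn f (Set.Icc (-1 : ℝ) 1))
    (hf : ∀ y ∈ Set.Ioo (-1 : ℝ) 1, HasDerivAt f (f' y) y)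
    (hf' : ∀ y ∈ Set.Ioo (-1 : ℝ) 1, HasDerivAt f' (f'' y) y)
    (htop : 0 ≤ f 1) (hbot : 0 ≤ f (-1))
    (hlt : ∀ y ∈ Set.Ioo (-1 : ℝ) 1, f y < 0 → f'' y < -κ ^ 2 * f y) :
    ∀ y ∈ Set.Icc (-1 : ℝ) 1, 0 ≤ f y := by
  refine nonneg_of_laplacian_lt hκ0 hκ1 (u := fun _ => f) (ux := fun _ _ => 0)
    (uxx := fun _ _ => 0) (uy := fun _ => f') (uyy := fun _ => f'') (fun _ _ _ => rfl)
    (hcont.comp continuousOn_snd fun p hp => hp.2) (fun x y _ => hasDerivAt_const x (f y))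
    (fun x y _ => hasDerivAt_const x 0) (fun _ => hf) (fun _ => hf') (fun _ => htop)
    (fun _ => hbot) (fun _ y hy h => by simpa using hlt y hy h) 0

theorem contDiffAt_two_hasDerivAt {f : ℝ → ℝ} {x : ℝ} (h : ContDiffAt ℝ 2 f x) :
    HasDerivAt f (deriv f x) x ∧ HasDerivAt (deriv f) (iteratedDeriv 2 f x) x := by
  refine ⟨(h.differentiableAt (by norm_num)).hasDerivAt, ?_⟩
  rw [iteratedDeriv_succ, iteratedDeriv_one]
  exact ((h.derivWithin (m := 1) (by norm_num)).differentiableAt (by norm_num)).hasDerivAt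

namespace IsClassicalOnChannel

variable {u v : ℝ → ℝ → ℝ}

theorem contDiffAt (hu : IsClassicalOnChannel u) (x : ℝ) {y : ℝ} (hy : y ∈ Set.Ioo (-1 : ℝ) 1) :
    ContDiffAt ℝ 2 (Function.uncurry u) (x, y) :=
  hu.contDiffOn.contDiffAt ((isOpen_univ.prod isOpen_Ioo).mem_nhds ⟨trivial, hy⟩)

theorem contDiffAt_left (hu : IsClassicalOnChannel u) (x : ℝ) {y : ℝ}
    (hy : y ∈ Set.Ioo (-1 : ℝ) 1) : ContDiffAt ℝ 2 (fun s => u s y) x :=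
  (hu.contDiffAt x hy).comp x (f := fun s : ℝ => (s, y)) (by fun_prop)

theorem contDiffAt_right (hu : IsClassicalOnChannel u) (x : ℝ) {y : ℝ}
    (hy : y ∈ Set.Ioo (-1 : ℝ) 1) : ContDiffAt ℝ 2 (fun t => u x t) y :=
  (hu.contDiffAt x hy).comp y (f := fun t : ℝ => (x, t)) (by fun_prop)

theorem sub (hu : IsClassicalOnChannel u) (hv : IsClassicalOnChannel v) :
    IsClassicalOnChannel (fun x y => u x y - v x y) :=
  ⟨fun x y hy => by rw [hu.periodic x y hy, hv.periodic x y hy],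
    hu.contDiffOn.sub hv.contDiffOn, hu.continuousOn.sub hv.continuousOn⟩

theorem add (hu : IsClassicalOnChannel u) (hv : IsClassicalOnChannel v) :
    IsClassicalOnChannel (fun x y => u x y + v x y) :=
  ⟨fun x y hy => by rw [hu.periodic x y hy, hv.periodic x y hy],
    hu.contDiffOn.add hv.contDiffOn, hu.continuousOn.add hv.continuousOn⟩

theorem const_mul (c : ℝ) (hu : IsClassicalOnChannel u) :
    IsClassicalOnChannel (fun x y => c * u x y) :=
  ⟨fun x y hy => by rw [hu.periodic x y hy],
    contDiffOn_const.mul hu.contDiffOn, continuousOn_const.mul hu.continuousOn⟩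

theorem laplacian_sub (hu : IsClassicalOnChannel u) (hv : IsClassicalOnChannel v) (x : ℝ) {y : ℝ}
    (hy : y ∈ Set.Ioo (-1 : ℝ) 1) :
    channelLaplacian (fun x y => u x y - v x y) x y =
      channelLaplacian u x y - channelLaplacian v x y := by
  unfold channelLaplacian
  have h1 := iteratedDeriv_fun_sub (hu.contDiffAt_left x hy) (hv.contDiffAt_left x hy)
  have h2 := iteratedDeriv_fun_sub (hu.contDiffAt_right x hy) (hv.contDiffAt_right x hy)
  rw [h1, h2]
  ring

theorem laplacian_add (hu : IsClassicalOnChannel u) (hv : IsClassicalOnChannel v) (x : ℝ) {y : ℝ}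
    (hy : y ∈ Set.Ioo (-1 : ℝ) 1) :
    channelLaplacian (fun x y => u x y + v x y) x y =
      channelLaplacian u x y + channelLaplacian v x y := by
  unfold channelLaplacian
  have h1 := iteratedDeriv_fun_add (hu.contDiffAt_left x hy) (hv.contDiffAt_left x hy)
  have h2 := iteratedDeriv_fun_add (hu.contDiffAt_right x hy) (hv.contDiffAt_right x hy)
  rw [h1, h2]
  ring

theorem laplacian_const_mul (c : ℝ) (u : ℝ → ℝ → ℝ) (x y : ℝ) :
    channelLaplacian (fun x y => c * u x y) x y = c * channelLaplacian u x y := by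
  unfold channelLaplacian
  rw [iteratedDeriv_const_mul_field, iteratedDeriv_const_mul_field, mul_add]

theorem nonneg (hu : IsClassicalOnChannel u) {κ : ℝ} (hκ0 : 0 ≤ κ) (hκ1 : κ < Real.pi / 2)
    (htop : ∀ x, 0 ≤ u x 1) (hbot : ∀ x, 0 ≤ u x (-1))
    (hlap : ∀ x, ∀ y ∈ Set.Ioo (-1 : ℝ) 1, u x y < 0 → channelLaplacian u x y < -κ ^ 2 * u x y) :
    ∀ x, ∀ y ∈ Set.Icc (-1 : ℝ) 1, 0 ≤ u x y :=
  nonneg_of_laplacian_lt hκ0 hκ1 hu.periodic hu.continuousOn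
    (fun x _ hy => (contDiffAt_two_hasDerivAt (hu.contDiffAt_left x hy)).1)
    (fun x _ hy => (contDiffAt_two_hasDerivAt (hu.contDiffAt_left x hy)).2)
    (fun x _ hy => (contDiffAt_two_hasDerivAt (hu.contDiffAt_right x hy)).1)
    (fun x _ hy => (contDiffAt_two_hasDerivAt (hu.contDiffAt_right x hy)).2) htop hbot hlap

/-- A solution of `Δu = q u` with zero boundary values vanishes if `q > -κ²`. -/
theorem eq_zero (hu : IsClassicalOnChannel u) {κ : ℝ} (hκ0 : 0 ≤ κ) (hκ1 : κ < Real.pi / 2)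
    {q : ℝ → ℝ → ℝ} (hq : ∀ x, ∀ y ∈ Set.Ioo (-1 : ℝ) 1, -κ ^ 2 < q x y)
    (heq : ∀ x, ∀ y ∈ Set.Ioo (-1 : ℝ) 1, channelLaplacian u x y = q x y * u x y)
    (htop : ∀ x, u x 1 = 0) (hbot : ∀ x, u x (-1) = 0) :
    ∀ x, ∀ y ∈ Set.Icc (-1 : ℝ) 1, u x y = 0 := by
  have h1 := hu.nonneg hκ0 hκ1 (fun x => (htop x).ge) (fun x => (hbot x).ge) fun x y hy h => by
    rw [heq x y hy]
    exact mul_lt_mul_of_neg_right (hq x y hy) h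
  have h2 := (hu.const_mul (-1)).nonneg hκ0 hκ1 (fun x => by simp [htop x])
    (fun x => by simp [hbot x]) fun x y hy h => by
      rw [laplacian_const_mul, heq x y hy]
      nlinarith [hq x y hy]
  intro x y hy
  exact le_antisymm (by linarith [h2 x y hy]) (h1 x y hy)

end IsClassicalOnChannel

/-! ### The first eigenvalue and the choice of `κ` -/

theorem isClassicalOnChannel_cos (κ : ℝ) : IsClassicalOnChannel (fun _ y => Real.cos (κ * y)) := by
  refine ⟨fun _ _ _ => rfl, ContDiff.contDiffOn ?_, Continuous.continuousOn ?_⟩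
  · exact Real.contDiff_cos.comp (contDiff_const.mul contDiff_snd)
  · exact Real.continuous_cos.comp (continuous_const.mul continuous_snd)

theorem channelLaplacian_cos (κ x y : ℝ) :
    channelLaplacian (fun _ y => Real.cos (κ * y)) x y = -κ ^ 2 * Real.cos (κ * y) := by
  have h1 : deriv (fun t => Real.cos (κ * t)) = fun t => -κ * Real.sin (κ * t) :=
    funext fun t => (hasDerivAt_cos_mul _ t).deriv
  simp only [channelLaplacian, iteratedDeriv_succ, iteratedDeriv_zero, h1,
    (hasDerivAt_neg_mul_sin_mul _ y).deriv, deriv_const']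
  ring

/-- The witness is `cos (π y / 2)`. The infimum is over a set bounded below by `0`: for `μ < 0` the
maximum principle with `κ = 0` kills every eigenfunction. -/
theorem firstDirichletEigenvalue_le : firstDirichletEigenvalue ≤ Real.pi ^ 2 / 4 := by
  refine csInf_le ⟨0, ?_⟩ ?_
  · rintro μ ⟨u, hu, heq, hbd, x, y, hy, hne⟩
    by_contra! hμ
    refine hne (hu.eq_zero le_rfl (by positivity) (q := fun _ _ => -μ) (fun _ _ _ => by simpa)
      (fun x y hy => by linarith [heq x y hy]) (fun x => (hbd x).1) (fun x => (hbd x).2) x y hy)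
  · refine ⟨_, isClassicalOnChannel_cos (Real.pi / 2), fun x y _ => ?_, fun x => by simp, 0, 0,
      by norm_num, by simp⟩
    rw [channelLaplacian_cos]
    ring

/-- A continuous function above `-λ₁` on a compact interval is above `-κ²` for some `κ < π / 2`. -/
theorem exists_kappa {f : ℝ → ℝ} (hf : Continuous f)
    (hlt : ∀ s, -firstDirichletEigenvalue < f s) (R : ℝ) :
    ∃ κ, 0 ≤ κ ∧ κ < Real.pi / 2 ∧ ∀ s, |s| ≤ R → -κ ^ 2 < f s := by
  rcases lt_or_ge R 0 with hR | hR
  · exact ⟨0, le_rfl, by positivity, fun s hs => absurd (abs_nonneg s) (by linarith)⟩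
  obtain ⟨s₀, _, hmin⟩ := (isCompact_Icc (a := -R) (b := R)).exists_isMinOn
    ⟨0, by constructor <;> linarith⟩ hf.continuousOn
  have h0 : -(Real.pi ^ 2 / 4) < f s₀ := by linarith [hlt s₀, firstDirichletEigenvalue_le]
  -- `ρ = κ²` is the midpoint between `π² / 4` and the largest value of `-f`, the latter cut off at
  -- `0` so that the square root can be taken.
  set ρ := (max (-f s₀) 0 + Real.pi ^ 2 / 4) / 2 with hρ
  have hpi : 0 < Real.pi ^ 2 / 4 := by positivity
  have hmax : max (-f s₀) 0 < Real.pi ^ 2 / 4 := max_lt (by linarith) hpi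
  have hρ0 : 0 ≤ ρ := by
    have := le_max_right (-f s₀) 0
    rw [hρ]; linarith
  refine ⟨√ρ, Real.sqrt_nonneg _, ?_, fun s hs => ?_⟩
  · rw [Real.sqrt_lt' (by positivity)]
    rw [hρ]; linarith
  · have h1 : f s₀ ≤ f s := hmin (abs_le.1 hs)
    have h2 := le_max_left (-f s₀) 0
    rw [Real.sq_sqrt hρ0, hρ]
    linarith

/-! ### A linear initial value problem -/

/-- Truncation of a real number to `[-R, R]`. -/
noncomputable def truncate (R x : ℝ) : ℝ := max (-R) (min R x)

theorem lipschitzWith_truncate (R : ℝ) : LipschitzWith 1 (truncate R) :=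
  (LipschitzWith.id.const_min R).const_max (-R)

theorem abs_truncate_le {R : ℝ} (hR : 0 ≤ R) (x : ℝ) : |truncate R x| ≤ R :=
  abs_le.2 ⟨le_max_left _ _, max_le (by linarith) (min_le_left _ _)⟩

theorem abs_truncate_le_abs {R : ℝ} (hR : 0 ≤ R) (x : ℝ) : |truncate R x| ≤ |x| := by
  unfold truncate
  rcases abs_cases x with h | h <;> rcases max_cases (-R) (min R x) with h' | h' <;>
    rcases min_cases R x with h'' | h'' <;> refine abs_le.2 ⟨?_, ?_⟩ <;> linarith

theorem truncate_of_abs_le {R x : ℝ} (h : |x| ≤ R) : truncate R x = x := by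
  unfold truncate
  rw [min_eq_right (abs_le.1 h).2, max_eq_right (abs_le.1 h).1]

/-- The initial value problem `u'' = Q u`, `u (-1) = 0`, `u' (-1) = 1` is solvable
on `[-1, 1]`. -/
theorem exists_second_order_linear_ivp {Q : ℝ → ℝ} (hQ : ContinuousOn Q (Set.Icc (-1 : ℝ) 1)) :
    ∃ u v : ℝ → ℝ, u (-1) = 0 ∧ v (-1) = 1 ∧ ∀ t ∈ Set.Icc (-1 : ℝ) 1,
      HasDerivWithinAt u (v t) (Set.Icc (-1) 1) t ∧
      HasDerivWithinAt v (Q t * u t) (Set.Icc (-1) 1) t := by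
  obtain ⟨M₀, hM₀⟩ := isCompact_Icc.exists_bound_of_continuousOn hQ
  obtain ⟨M, hM1, hM⟩ : ∃ M : ℝ≥0, 1 ≤ M ∧ ∀ t ∈ Set.Icc (-1 : ℝ) 1, |Q t| ≤ M :=
    ⟨max 1 M₀.toNNReal, le_max_left _ _, fun t ht =>
      (hM₀ t ht).trans ((Real.le_coe_toNNReal _).trans (by exact_mod_cast le_max_right _ _))⟩
  have hM1' : (1 : ℝ) ≤ M := by exact_mod_cast hM1
  -- `exp (2 M)` is the Grönwall bound on an interval of length `2` for initial norm `1`, so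
  -- truncation at this level never acts on the solution.
  obtain ⟨R, hR⟩ : ∃ R : ℝ≥0, (R : ℝ) = Real.exp (2 * M) :=
    ⟨⟨Real.exp (2 * M), (Real.exp_pos _).le⟩, rfl⟩
  have hR0 : (0 : ℝ) ≤ R := R.2
  let f : ℝ → ℝ × ℝ → ℝ × ℝ := fun t p => (truncate R p.2, Q t * truncate R p.1)
  have hnorm : ∀ t ∈ Set.Icc (-1 : ℝ) 1, ∀ p : ℝ × ℝ, ∀ B : ℝ,
      |truncate R p.1| ≤ B → |truncate R p.2| ≤ B → ‖f t p‖ ≤ M * B := by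
    intro t ht p B h1 h2
    have hB : 0 ≤ B := (abs_nonneg _).trans h1
    refine max_le ?_ ?_
    · exact h2.trans (le_mul_of_one_le_left hB hM1')
    · rw [Real.norm_eq_abs, abs_mul]
      exact mul_le_mul (hM t ht) h1 (abs_nonneg _) M.2
  -- Truncation bounds the field by `M R`, so a ball of radius `M R * 2` contains the motion over
  -- the whole interval and one Picard–Lindelöf step suffices.
  have hPL : IsPicardLindelof f (tmin := -1) (tmax := 1) ⟨-1, by norm_num⟩ ((0, 1) : ℝ × ℝ)
      (M * R * 2) 0 (M * R) M := by
    refine ⟨fun t ht => LipschitzWith.lipschitzOnWith ?_, fun p _ => ?_, fun t ht p _ => ?_, ?_⟩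
    · refine LipschitzWith.of_dist_le_mul fun p p' => ?_
      have h1 := (lipschitzWith_truncate R).dist_le_mul p.1 p'.1
      have h2 := (lipschitzWith_truncate R).dist_le_mul p.2 p'.2
      rw [NNReal.coe_one, one_mul] at h1 h2
      refine max_le ?_ ?_
      · exact h2.trans ((le_max_right _ _).trans
          (le_mul_of_one_le_left (le_max_of_le_left dist_nonneg) hM1'))
      · change dist (Q t * _) (Q t * _) ≤ _
        rw [Real.dist_eq, ← mul_sub, abs_mul, ← Real.dist_eq]
        exact mul_le_mul (hM t ht) (h1.trans (le_max_left _ _)) dist_nonneg M.2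
    · exact continuousOn_const.prodMk (hQ.mul continuousOn_const)
    · rw [NNReal.coe_mul]
      exact hnorm t ht p R (abs_truncate_le hR0 _) (abs_truncate_le hR0 _)
    · norm_num
  obtain ⟨γ, hγ0, hγ⟩ := hPL.exists_eq_forall_mem_Icc_hasDerivWithinAt₀
  have hγ0' : γ (-1) = (0, 1) := hγ0
  have hcont : ContinuousOn γ (Set.Icc (-1) 1) := fun t ht => (hγ t ht).continuousWithinAt
  have hgr := norm_le_gronwallBound_of_norm_deriv_right_le (δ := 1) (K := M) (ε := 0) hcont
    (f' := fun t => f t (γ t))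
    (fun t ht => (hγ t (Set.Ico_subset_Icc_self ht)).mono_of_mem_nhdsWithin
      (mem_nhdsWithin.2 ⟨Set.Iio 1, isOpen_Iio, ht.2, fun s hs => ⟨ht.1.trans hs.2, hs.1.le⟩⟩))
    (by simp [hγ0', Prod.norm_def]) (fun t ht => by
      rw [add_zero]
      exact hnorm t (Set.Ico_subset_Icc_self ht) _ _
        ((abs_truncate_le_abs hR0 _).trans (norm_fst_le (γ t)))
        ((abs_truncate_le_abs hR0 _).trans (norm_snd_le (γ t))))
  have hbound : ∀ t ∈ Set.Icc (-1 : ℝ) 1, ‖γ t‖ ≤ R := by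
    intro t ht
    refine (hgr t ht).trans ?_
    rw [gronwallBound_ε0, one_mul, hR]
    refine Real.exp_le_exp.2 ?_
    nlinarith [ht.2]
  refine ⟨fun t => (γ t).1, fun t => (γ t).2, by simp [hγ0'], by simp [hγ0'], fun t ht => ?_⟩
  have h1 : |(γ t).1| ≤ R := (norm_fst_le (γ t)).trans (hbound t ht)
  have h2 : |(γ t).2| ≤ R := (norm_snd_le (γ t)).trans (hbound t ht)
  have hd := hγ t ht
  have he : f t (γ t) = ((γ t).2, Q t * (γ t).1) := by
    simp only [f, truncate_of_abs_le h1, truncate_of_abs_le h2]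
  rw [he] at hd
  exact ⟨hd.fst, hd.snd⟩

/-! ### Vertical profiles and their decay -/

/-- `A` solves `A'' = Q A` in `(-1, 1)` with `A (-1) = 0` and `A 1 = 1`. -/
structure IsDirichletProfile (Q A A' : ℝ → ℝ) : Prop where
  continuousOn : ContinuousOn A (Set.Icc (-1 : ℝ) 1)
  hasDerivAt : ∀ y ∈ Set.Ioo (-1 : ℝ) 1, HasDerivAt A (A' y) y
  hasDerivAt' : ∀ y ∈ Set.Ioo (-1 : ℝ) 1, HasDerivAt A' (Q y * A y) y
  top : A 1 = 1
  bottom : A (-1) = 0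

namespace IsDirichletProfile

variable {κ : ℝ} {Q A A' : ℝ → ℝ}

theorem exists_profile (hκ0 : 0 ≤ κ) (hκ1 : κ < Real.pi / 2)
    (hQc : ContinuousOn Q (Set.Icc (-1 : ℝ) 1)) (hQ : ∀ y ∈ Set.Icc (-1 : ℝ) 1, -κ ^ 2 < Q y) :
    ∃ A A' : ℝ → ℝ, IsDirichletProfile Q A A' := by
  obtain ⟨u, v, hu, hv, huv⟩ := exists_second_order_linear_ivp hQc
  have hnhds : ∀ y ∈ Set.Ioo (-1 : ℝ) 1, Set.Icc (-1 : ℝ) 1 ∈ nhds y := fun y hy =>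
    Icc_mem_nhds hy.1 hy.2
  have hcont : ContinuousOn u (Set.Icc (-1 : ℝ) 1) := fun t ht => (huv t ht).1.continuousWithinAt
  have hd : ∀ y ∈ Set.Ioo (-1 : ℝ) 1, HasDerivAt u (v y) y := fun y hy =>
    (huv y (Set.Ioo_subset_Icc_self hy)).1.hasDerivAt (hnhds y hy)
  have hd' : ∀ y ∈ Set.Ioo (-1 : ℝ) 1, HasDerivAt v (Q y * u y) y := fun y hy =>
    (huv y (Set.Ioo_subset_Icc_self hy)).2.hasDerivAt (hnhds y hy)
  -- Shooting: if `u 1 = 0`, the maximum principle for `u` and `-u` gives `u = 0`, against the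
  -- initial slope `1`. Division by `u 1` then normalizes the profile.
  have hne : u 1 ≠ 0 := by
    intro h1
    have hp := nonneg_of_second_deriv_lt hκ0 hκ1 hcont hd hd' h1.ge hu.ge fun y hy h =>
      mul_lt_mul_of_neg_right (hQ y (Set.Ioo_subset_Icc_self hy)) h
    have hn := nonneg_of_second_deriv_lt hκ0 hκ1 hcont.neg (fun y hy => (hd y hy).neg)
      (fun y hy => (hd' y hy).neg) (by simp [h1]) (by simp [hu]) fun y hy h => by
        simp only [Pi.neg_apply] at h ⊢
        nlinarith [hQ y (Set.Ioo_subset_Icc_self hy)]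
    have hz : ∀ y ∈ Set.Icc (-1 : ℝ) 1, u y = 0 := fun y hy =>
      le_antisymm (by simpa using hn y hy) (hp y hy)
    have h0 : HasDerivWithinAt u 0 (Set.Icc (-1) 1) (-1) :=
      (hasDerivWithinAt_const (-1 : ℝ) (Set.Icc (-1 : ℝ) 1) (0 : ℝ)).congr hz
        (hz _ (by norm_num))
    have hv0 := (uniqueDiffOn_Icc (by norm_num : (-1 : ℝ) < 1) (-1) (by norm_num)).eq_deriv _
      (huv (-1) (by norm_num)).1 h0
    rw [hv] at hv0
    exact one_ne_zero hv0
  refine ⟨fun y => u y / u 1, fun y => v y / u 1, hcont.div_const _,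
    fun y hy => (hd y hy).div_const _, fun y hy => ?_, div_self hne, by simp [hu]⟩
  refine ((hd' y hy).div_const _).congr_deriv ?_
  ring

/-- Where `w < A`, `(w - A)'' ≤ Q (w - A) < -κ² (w - A)`, so the maximum principle excludes this. -/
theorem le_of_supersolution (hA : IsDirichletProfile Q A A') (hκ0 : 0 ≤ κ) (hκ1 : κ < Real.pi / 2)
    (hQ : ∀ y ∈ Set.Icc (-1 : ℝ) 1, -κ ^ 2 < Q y) {w w' w'' : ℝ → ℝ}
    (hw : ∀ y, HasDerivAt w (w' y) y) (hw' : ∀ y, HasDerivAt w' (w'' y) y)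
    (hsup : ∀ y ∈ Set.Ioo (-1 : ℝ) 1, w'' y ≤ Q y * w y) (htop : 1 ≤ w 1) (hbot : 0 ≤ w (-1))
    {y : ℝ} (hy : y ∈ Set.Icc (-1 : ℝ) 1) : A y ≤ w y := by
  have := nonneg_of_second_deriv_lt hκ0 hκ1
    (ContinuousOn.sub (fun y _ => (hw y).continuousAt.continuousWithinAt) hA.continuousOn)
    (fun y hy => (hw y).sub (hA.hasDerivAt y hy)) (fun y hy => (hw' y).sub (hA.hasDerivAt' y hy))
    (by simp [hA.top, htop]) (by simp [hA.bottom, hbot])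
    (fun y hy h => by
      simp only [Pi.sub_apply] at h ⊢
      nlinarith [hQ y (Set.Ioo_subset_Icc_self hy), hsup y hy]) y hy
  simpa using this

theorem ge_of_subsolution (hA : IsDirichletProfile Q A A') (hκ0 : 0 ≤ κ) (hκ1 : κ < Real.pi / 2)
    (hQ : ∀ y ∈ Set.Icc (-1 : ℝ) 1, -κ ^ 2 < Q y) {w w' w'' : ℝ → ℝ}
    (hw : ∀ y, HasDerivAt w (w' y) y) (hw' : ∀ y, HasDerivAt w' (w'' y) y)
    (hsub : ∀ y ∈ Set.Ioo (-1 : ℝ) 1, Q y * w y ≤ w'' y) (htop : w 1 ≤ 1) (hbot : w (-1) ≤ 0)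
    {y : ℝ} (hy : y ∈ Set.Icc (-1 : ℝ) 1) : w y ≤ A y := by
  have := nonneg_of_second_deriv_lt hκ0 hκ1
    (hA.continuousOn.sub (fun y _ => (hw y).continuousAt.continuousWithinAt))
    (fun y hy => (hA.hasDerivAt y hy).sub (hw y)) (fun y hy => (hA.hasDerivAt' y hy).sub (hw' y))
    (by simp [hA.top, htop]) (by simp [hA.bottom, hbot])
    (fun y hy h => by
      simp only [Pi.sub_apply] at h ⊢
      nlinarith [hQ y (Set.Ioo_subset_Icc_self hy), hsub y hy]) y hy
  simpa using this

theorem nonneg (hA : IsDirichletProfile Q A A') (hκ0 : 0 ≤ κ) (hκ1 : κ < Real.pi / 2)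
    (hQ : ∀ y ∈ Set.Icc (-1 : ℝ) 1, -κ ^ 2 < Q y) {y : ℝ} (hy : y ∈ Set.Icc (-1 : ℝ) 1) :
    0 ≤ A y :=
  hA.ge_of_subsolution hκ0 hκ1 hQ (w := fun _ => 0) (w' := fun _ => 0) (w'' := fun _ => 0)
    (fun y => hasDerivAt_const y 0) (fun y => hasDerivAt_const y 0) (by simp) (by simp) le_rfl hy

/-- The supersolution `cos (κ y) / cos κ` equals `1` at both ends; the bound does not depend on `Q`,
hence is uniform over Fourier modes. -/
theorem le_inv_cos (hA : IsDirichletProfile Q A A') (hκ0 : 0 ≤ κ) (hκ1 : κ < Real.pi / 2)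
    (hQ : ∀ y ∈ Set.Icc (-1 : ℝ) 1, -κ ^ 2 < Q y) {y : ℝ} (hy : y ∈ Set.Icc (-1 : ℝ) 1) :
    A y ≤ 1 / Real.cos κ := by
  have hc : 0 < Real.cos κ := by simpa using cos_mul_pos hκ0 hκ1 (y := 1) (by norm_num)
  refine (hA.le_of_supersolution hκ0 hκ1 hQ (w := fun t => Real.cos (κ * t) / Real.cos κ)
    (fun y => (hasDerivAt_cos_mul κ y).div_const _)
    (fun y => (hasDerivAt_neg_mul_sin_mul κ y).div_const _) (fun t ht => ?_) ?_ ?_ hy).trans ?_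
  · rw [mul_div_assoc]
    have ht' := Set.Ioo_subset_Icc_self ht
    exact mul_le_mul_of_nonneg_right (hQ t ht').le
      (div_nonneg (cos_mul_pos hκ0 hκ1 ht').le hc.le)
  · simp [div_self hc.ne']
  · simp [div_self hc.ne']
  · exact div_le_div_of_nonneg_right (Real.cos_le_one _) hc.le

/-- The exponential solves `w'' = m² w` and is a supersolution as `m² ≤ Q`. This is the source of
decay away from the top edge. -/
theorem le_exp (hA : IsDirichletProfile Q A A') (hκ0 : 0 ≤ κ) (hκ1 : κ < Real.pi / 2)
    (hQ : ∀ y ∈ Set.Icc (-1 : ℝ) 1, -κ ^ 2 < Q y) {m : ℝ}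
    (hm : ∀ y ∈ Set.Icc (-1 : ℝ) 1, m ^ 2 ≤ Q y) {y : ℝ} (hy : y ∈ Set.Icc (-1 : ℝ) 1) :
    A y ≤ Real.exp (m * (y - 1)) := by
  have hd : ∀ y, HasDerivAt (fun t => Real.exp (m * (t - 1))) (m * Real.exp (m * (y - 1))) y := by
    intro y
    refine ((((hasDerivAt_id y).sub_const 1).const_mul m).exp).congr_deriv ?_
    simp
    ring
  refine hA.le_of_supersolution hκ0 hκ1 hQ hd (fun y => (hd y).const_mul m) (fun t ht => ?_)
    (by simp) (Real.exp_pos _).le hy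
  rw [← mul_assoc, ← sq]
  exact mul_le_mul_of_nonneg_right (hm t (Set.Ioo_subset_Icc_self ht)) (Real.exp_pos _).le

/-- Compare from below with `sinh (M (y + 1)) / sinh (2 M)`; adding `1` to the bound `K` of `|Q|`
ensures both `M > 0` and `M² ≥ Q`. -/
theorem pos (hA : IsDirichletProfile Q A A') (hκ0 : 0 ≤ κ) (hκ1 : κ < Real.pi / 2)
    (hQc : ContinuousOn Q (Set.Icc (-1 : ℝ) 1)) (hQ : ∀ y ∈ Set.Icc (-1 : ℝ) 1, -κ ^ 2 < Q y)
    {y : ℝ} (hy : y ∈ Set.Ioo (-1 : ℝ) 1) : 0 < A y := by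
  obtain ⟨K, hK⟩ := isCompact_Icc.exists_bound_of_continuousOn hQc
  have hK0 : 0 ≤ K := (norm_nonneg _).trans (hK 0 (by norm_num))
  set M := K + 1 with hM
  have hMp : 0 < M := by linarith
  have hs : 0 < Real.sinh (M * (1 + 1)) := Real.sinh_pos_iff.2 (by positivity)
  have hlin : ∀ y, HasDerivAt (fun t : ℝ => M * (t + 1)) M y := fun y => by
    simpa using ((hasDerivAt_id y).add_const 1).const_mul M
  have h1 : ∀ y, HasDerivAt (fun t => Real.sinh (M * (t + 1)) / Real.sinh (M * (1 + 1)))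
      (Real.cosh (M * (y + 1)) * M / Real.sinh (M * (1 + 1))) y := fun y =>
    ((hlin y).sinh).div_const _
  have h2 : ∀ y, HasDerivAt (fun t => Real.cosh (M * (t + 1)) * M / Real.sinh (M * (1 + 1)))
      (Real.sinh (M * (y + 1)) * M * M / Real.sinh (M * (1 + 1))) y := fun y =>
    (((hlin y).cosh).mul_const M).div_const _
  have hle := hA.ge_of_subsolution hκ0 hκ1 hQ h1 h2 (fun t ht => ?_) ?_ ?_
    (Set.Ioo_subset_Icc_self hy)
  · refine lt_of_lt_of_le (div_pos (Real.sinh_pos_iff.2 ?_) hs) hle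
    exact mul_pos hMp (by linarith [hy.1])
  · have hq : Q t ≤ M * M := by
      have := (le_abs_self _).trans (hK t (Set.Ioo_subset_Icc_self ht))
      nlinarith
    have hp : 0 ≤ Real.sinh (M * (t + 1)) / Real.sinh (M * (1 + 1)) :=
      div_nonneg (Real.sinh_nonneg_iff.2 (mul_nonneg hMp.le (by linarith [ht.1]))) hs.le
    calc _ ≤ M * M * (Real.sinh (M * (t + 1)) / Real.sinh (M * (1 + 1))) :=
          mul_le_mul_of_nonneg_right hq hp
      _ = _ := by ring
  · exact (div_self hs.ne').le
  · simp

end IsDirichletProfile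

/-- Interpolation bound for the first derivative at scale `d / N`. -/
theorem abs_deriv_le_of_bounds {f f' f'' : ℝ → ℝ} {a b y d N B : ℝ} (hd : 0 < d) (hN : 1 ≤ N)
    (hf : ∀ t ∈ Set.Ioo a b, HasDerivAt f (f' t) t)
    (hf' : ∀ t ∈ Set.Ioo a b, HasDerivAt f' (f'' t) t)
    (h0 : ∀ t ∈ Set.Ioo a b, 0 ≤ f t) (h1 : ∀ t ∈ Set.Ioo a b, N ^ 2 * f t ≤ B)
    (h2 : ∀ t ∈ Set.Ioo a b, |f'' t| ≤ B) (hya : a < y) (hyb : y + d < b) :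
    N * |f' y| ≤ B / d + B * d := by
  have hN0 : 0 < N := by linarith
  -- The mean value theorem on `[y, y + s]` gives a point `ξ` with `|f' ξ| ≤ B / (N² s)`, and `f'`
  -- varies by at most `B s` between `y` and `ξ`. With this `s` both terms are of order `1 / N`.
  set s := d / N with hs
  have hs0 : 0 < s := by positivity
  have hsd : s ≤ d := div_le_self hd.le hN
  have hsub : Set.Icc y (y + s) ⊆ Set.Ioo a b := fun t ht =>
    ⟨by linarith [ht.1], by linarith [ht.2]⟩
  have hy : y ∈ Set.Ioo a b := hsub ⟨le_rfl, by linarith⟩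
  have hys : y + s ∈ Set.Ioo a b := hsub ⟨by linarith, le_rfl⟩
  have hB : 0 ≤ B := (abs_nonneg _).trans (h2 y hy)
  obtain ⟨ξ, hξ, he⟩ := exists_hasDerivAt_eq_slope f f' (show y < y + s by linarith)
    (fun t ht => (hf t (hsub ht)).continuousAt.continuousWithinAt)
    (fun t ht => hf t (hsub (Set.Ioo_subset_Icc_self ht)))
  obtain ⟨η, hη, he'⟩ := exists_hasDerivAt_eq_slope f' f'' hξ.1
    (fun t ht => (hf' t (hsub ⟨ht.1, ht.2.trans hξ.2.le⟩)).continuousAt.continuousWithinAt)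
    (fun t ht => hf' t (hsub ⟨ht.1.le, ht.2.le.trans hξ.2.le⟩))
  have hfB : ∀ t ∈ Set.Ioo a b, f t ≤ B / N ^ 2 := fun t ht => by
    rw [le_div_iff₀ (by positivity), mul_comm]
    exact h1 t ht
  have hξB : |f' ξ| ≤ B / N ^ 2 / s := by
    rw [he, add_sub_cancel_left, abs_div, abs_of_pos hs0]
    refine div_le_div_of_nonneg_right (abs_le.2 ⟨?_, ?_⟩) hs0.le
    · linarith [hfB y hy, h0 (y + s) hys]
    · linarith [hfB (y + s) hys, h0 y hy]
  have hdiff : |f' ξ - f' y| ≤ B * s := by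
    have hpos : 0 < ξ - y := by linarith [hξ.1]
    have : f' ξ - f' y = f'' η * (ξ - y) := by
      rw [he', div_mul_cancel₀ _ hpos.ne']
    rw [this, abs_mul, abs_of_pos hpos]
    exact mul_le_mul (h2 η (hsub ⟨hη.1.le, hη.2.le.trans hξ.2.le⟩)) (by linarith [hξ.2])
      hpos.le hB
  have hy' : |f' y| ≤ B / N ^ 2 / s + B * s := by
    have := abs_sub_abs_le_abs_sub (f' y) (f' ξ)
    rw [abs_sub_comm] at this
    linarith
  calc N * |f' y| ≤ N * (B / N ^ 2 / s + B * s) := mul_le_mul_of_nonneg_left hy' hN0.le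
    _ = B / d + B * d := by
      rw [hs]
      field_simp

/-- Each `x`-derivative of mode `n` costs a factor of at most `1 + |n|`. Below a height `c < 1` the
decay of the profile pays for two derivatives, uniformly in `n`. -/
theorem exists_profile_bounds {κ : ℝ} (hκ0 : 0 ≤ κ) (hκ1 : κ < Real.pi / 2) {q : ℝ → ℝ}
    (hqc : ContinuousOn q (Set.Icc (-1 : ℝ) 1)) (hq : ∀ y ∈ Set.Icc (-1 : ℝ) 1, -κ ^ 2 < q y)
    {A A' : ℤ → ℝ → ℝ} (hA : ∀ n : ℤ, IsDirichletProfile (fun y => (n : ℝ) ^ 2 + q y) (A n) (A' n))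
    {c : ℝ} (hc : c < 1) :
    ∃ C, ∀ n : ℤ, ∀ y ∈ Set.Ioo (-1 : ℝ) c, (1 + |(n : ℝ)|) ^ 2 * |A n y| ≤ C ∧
      (1 + |(n : ℝ)|) * |A' n y| ≤ C ∧ |((n : ℝ) ^ 2 + q y) * A n y| ≤ C := by
  obtain ⟨K, hK⟩ := isCompact_Icc.exists_bound_of_continuousOn hqc
  have hK0 : 0 ≤ K := (norm_nonneg _).trans (hK 0 (by norm_num))
  have hcos : 0 < Real.cos κ := by simpa using cos_mul_pos hκ0 hκ1 (y := 1) (by norm_num)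
  have hQ : ∀ n : ℤ, ∀ y ∈ Set.Icc (-1 : ℝ) 1, -κ ^ 2 < (n : ℝ) ^ 2 + q y := fun n y hy => by
    linarith [hq y hy, sq_nonneg (n : ℝ)]
  have hnn : ∀ n : ℤ, ∀ y ∈ Set.Icc (-1 : ℝ) 1, 0 ≤ A n y := fun n y hy =>
    (hA n).nonneg hκ0 hκ1 (hQ n) hy
  -- Of the gap between `c` and `1`, a piece `d` below `1` is kept for the decay, and the rest
  -- leaves room above `y` for the interpolation bound.
  set d := (1 - c) / 3 with hd
  have hd0 : 0 < d := by rw [hd]; linarith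
  set b := c + 2 * d with hb
  have hb1 : b = 1 - d := by rw [hb, hd]; ring
  -- The first summand covers `|n| ≥ 2` by exponential decay, the second `|n| ≤ 1` by `le_inv_cos`.
  set B₀ := 32 / d ^ 2 + 4 * (1 / Real.cos κ) with hB₀
  have hB₀0 : 0 ≤ B₀ := by positivity
  have hkey : ∀ n : ℤ, ∀ y ∈ Set.Ioo (-1 : ℝ) b, (1 + |(n : ℝ)|) ^ 2 * A n y ≤ B₀ := by
    intro n y hy
    have hy' : y ∈ Set.Icc (-1 : ℝ) 1 := ⟨hy.1.le, by linarith [hy.2]⟩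
    rcases lt_or_ge |n| 2 with hn | hn
    · have hn1 : |(n : ℝ)| ≤ 1 := by
        have : |n| ≤ 1 := by omega
        exact_mod_cast this
      have h1 : (1 + |(n : ℝ)|) ^ 2 ≤ 4 := by nlinarith [abs_nonneg (n : ℝ)]
      have h2 := mul_le_mul h1 ((hA n).le_inv_cos hκ0 hκ1 (hQ n) hy') (hnn n y hy') (by norm_num)
      have h3 : 0 ≤ 32 / d ^ 2 := by positivity
      rw [hB₀]
      linarith
    · have hn2 : (2 : ℝ) ≤ |(n : ℝ)| := by exact_mod_cast hn
      -- Since `κ² < π² / 4 < 3`, one has `n² + q ≥ n² - 3 ≥ n² / 4` for `|n| ≥ 2`.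
      have hm : ∀ t ∈ Set.Icc (-1 : ℝ) 1, (|(n : ℝ)| / 2) ^ 2 ≤ (n : ℝ) ^ 2 + q t := by
        intro t ht
        have h1 := hq t ht
        have h2 : κ ^ 2 < 3 := by nlinarith [Real.pi_lt_d2]
        rw [← sq_abs (n : ℝ)]
        nlinarith
      have h1 := (hA n).le_exp hκ0 hκ1 (hQ n) hm hy'
      set t := |(n : ℝ)| / 2 * (1 - y) with ht
      have ht0 : |(n : ℝ)| / 2 * d ≤ t :=
        mul_le_mul_of_nonneg_left (by linarith [hy.2]) (by positivity)
      have ht1 : 0 < |(n : ℝ)| / 2 * d := by positivity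
      have ht2 : 0 < t := by linarith
      -- Only quadratic decay is needed: `exp t ≥ 1 + t + t² / 2` gives `exp (-t) ≤ 2 / t²`.
      have h2 : A n y ≤ 2 / t ^ 2 := by
        refine h1.trans ?_
        have h3 := Real.quadratic_le_exp_of_nonneg ht2.le
        have h4 : |(n : ℝ)| / 2 * (y - 1) = -t := by rw [ht]; ring
        rw [h4, Real.exp_neg, inv_eq_one_div, div_le_div_iff₀ (Real.exp_pos _) (by positivity)]
        nlinarith
      have h3 : A n y ≤ 2 / (|(n : ℝ)| / 2 * d) ^ 2 := h2.trans (by gcongr)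
      have h4 : (1 + |(n : ℝ)|) ^ 2 ≤ (2 * |(n : ℝ)|) ^ 2 := by gcongr; linarith
      have h5 := mul_le_mul h4 h3 (hnn n y hy') (by positivity)
      have h6 : (2 * |(n : ℝ)|) ^ 2 * (2 / (|(n : ℝ)| / 2 * d) ^ 2) = 32 / d ^ 2 := by
        have : |(n : ℝ)| ≠ 0 := by positivity
        field_simp
        norm_num
      have h7 : 0 ≤ 4 * (1 / Real.cos κ) := by positivity
      rw [hB₀]
      linarith
  set B := (1 + K) * B₀ with hB
  have hBB : B₀ ≤ B := by rw [hB]; nlinarith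
  have hkey2 : ∀ n : ℤ, ∀ y ∈ Set.Ioo (-1 : ℝ) b, |((n : ℝ) ^ 2 + q y) * A n y| ≤ B := by
    intro n y hy
    have hy' : y ∈ Set.Icc (-1 : ℝ) 1 := ⟨hy.1.le, by linarith [hy.2]⟩
    have h1 : |(n : ℝ) ^ 2 + q y| ≤ (1 + K) * (1 + |(n : ℝ)|) ^ 2 := by
      have h2 := abs_le.1 (hK y hy')
      have h3 := sq_abs (n : ℝ)
      have h4 := abs_nonneg (n : ℝ)
      rw [abs_le]
      constructor <;> nlinarith [mul_nonneg hK0 h4, mul_nonneg hK0 (sq_nonneg |(n : ℝ)|)]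
    rw [abs_mul, abs_of_nonneg (hnn n y hy')]
    calc _ ≤ (1 + K) * (1 + |(n : ℝ)|) ^ 2 * A n y :=
          mul_le_mul_of_nonneg_right h1 (hnn n y hy')
      _ = (1 + K) * ((1 + |(n : ℝ)|) ^ 2 * A n y) := by ring
      _ ≤ _ := mul_le_mul_of_nonneg_left (hkey n y hy) (by linarith)
  have hsub : ∀ y ∈ Set.Ioo (-1 : ℝ) b, y ∈ Set.Ioo (-1 : ℝ) 1 := fun y hy =>
    ⟨hy.1, by linarith [hy.2]⟩
  refine ⟨max B (B / d + B * d), fun n y hy => ⟨?_, ?_, ?_⟩⟩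
  · have hy' : y ∈ Set.Ioo (-1 : ℝ) b := ⟨hy.1, by linarith [hy.2]⟩
    rw [abs_of_nonneg (hnn n y (Set.Ioo_subset_Icc_self (hsub y hy')))]
    exact (hkey n y hy').trans (hBB.trans (le_max_left _ _))
  · refine le_trans ?_ (le_max_right _ _)
    exact abs_deriv_le_of_bounds hd0 (by linarith [abs_nonneg (n : ℝ)])
      (fun t ht => (hA n).hasDerivAt t (hsub t ht)) (fun t ht => (hA n).hasDerivAt' t (hsub t ht))
      (fun t ht => hnn n t (Set.Ioo_subset_Icc_self (hsub t ht)))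
      (fun t ht => (hkey n t ht).trans hBB) (fun t ht => hkey2 n t ht) hy.1 (by linarith [hy.2])
  · exact (hkey2 n y ⟨hy.1, by linarith [hy.2]⟩).trans (le_max_left _ _)

/-! ### Termwise differentiation of separated series -/

theorem iteratedDeriv_two_eq {f f' : ℝ → ℝ} {x c : ℝ}
    (hf : ∀ᶠ y in nhds x, HasDerivAt f (f' y) y) (hf' : HasDerivAt f' c x) :
    iteratedDeriv 2 f x = c := by
  have hd : deriv f =ᶠ[nhds x] f' := hf.mono fun y hy => hy.deriv
  rw [iteratedDeriv_succ, iteratedDeriv_one, hd.deriv_eq, hf'.deriv]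

/-- The linear form `(s, t) ↦ P s + R t` on the plane. -/
noncomputable def planeForm (P R : ℝ) : ℝ × ℝ →L[ℝ] ℝ :=
  P • ContinuousLinearMap.fst ℝ ℝ ℝ + R • ContinuousLinearMap.snd ℝ ℝ ℝ

/-- The derivative combines two fixed linear forms with coefficients `P` and `R`, so it is as smooth
as they are. -/
theorem contDiffOn_succ_of_partials {f P R : ℝ × ℝ → ℝ} {U : Set (ℝ × ℝ)} (n : ℕ) (hU : IsOpen U)
    (hf : ∀ p ∈ U, HasFDerivAt f (planeForm (P p) (R p)) p) (hP : ContDiffOn ℝ n P U)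
    (hR : ContDiffOn ℝ n R U) : ContDiffOn ℝ (n + 1) f U := by
  rw [contDiffOn_succ_iff_hasFDerivWithinAt_of_uniqueDiffOn hU.uniqueDiffOn]
  refine ⟨fun h => absurd h (by simp), fun p => planeForm (P p) (R p), ?_,
    fun p hp => (hf p hp).hasFDerivWithinAt⟩
  exact (hP.smul contDiffOn_const).add (hR.smul contDiffOn_const)

theorem hasDerivAt_left_of_planeForm {f : ℝ × ℝ → ℝ} {P R x y : ℝ}
    (h : HasFDerivAt f (planeForm P R) (x, y)) : HasDerivAt (fun s => f (s, y)) P x := by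
  have := h.comp_hasDerivAt x ((hasDerivAt_id x).prodMk (hasDerivAt_const x y))
  exact this.congr_deriv (by simp [planeForm])

theorem hasDerivAt_right_of_planeForm {f : ℝ × ℝ → ℝ} {P R x y : ℝ}
    (h : HasFDerivAt f (planeForm P R) (x, y)) : HasDerivAt (fun t => f (x, t)) R y := by
  have := h.comp_hasDerivAt y ((hasDerivAt_const y x).prodMk (hasDerivAt_id y))
  exact this.congr_deriv (by simp [planeForm])

section SeparatedSeries

variable {ι : Type*} {e e' a a' : ι → ℝ → ℝ} {u : ι → ℝ} {l r : ℝ}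

theorem continuousOn_tsum_mul {s : Set ℝ} (hu : Summable u) (he : ∀ n, Continuous (e n))
    (ha : ∀ n, ContinuousOn (a n) s) (h : ∀ n x, ∀ y ∈ s, |e n x * a n y| ≤ u n) :
    ContinuousOn (fun p : ℝ × ℝ => ∑' n, e n p.1 * a n p.2) (Set.univ ×ˢ s) :=
  continuousOn_tsum (fun n => ((he n).comp continuous_fst).continuousOn.mul
    ((ha n).comp continuousOn_snd fun _ hp => hp.2)) hu fun n p hp => h n p.1 p.2 hp.2

/-- The coordinate projections have norm at most `1`, so the gradient of the `n`-th term is bounded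
by `u n + u n`, which is summable. It serves for the series and again for both of its first
partials. -/
theorem hasFDerivAt_tsum_mul (hu : Summable u)
    (he : ∀ n x, HasDerivAt (e n) (e' n x) x)
    (ha : ∀ n, ∀ y ∈ Set.Ioo l r, HasDerivAt (a n) (a' n y) y)
    (h0 : ∀ n x, ∀ y ∈ Set.Ioo l r, |e n x * a n y| ≤ u n)
    (h1 : ∀ n x, ∀ y ∈ Set.Ioo l r, |e' n x * a n y| ≤ u n)
    (h2 : ∀ n x, ∀ y ∈ Set.Ioo l r, |e n x * a' n y| ≤ u n)
    {p : ℝ × ℝ} (hp : p ∈ (Set.univ : Set ℝ) ×ˢ Set.Ioo l r) :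
    HasFDerivAt (fun p : ℝ × ℝ => ∑' n, e n p.1 * a n p.2)
      (planeForm (∑' n, e' n p.1 * a n p.2) (∑' n, e n p.1 * a' n p.2)) p := by
  have hs1 : Summable fun n => e' n p.1 * a n p.2 :=
    Summable.of_norm_bounded hu fun n => h1 n p.1 p.2 hp.2
  have hs2 : Summable fun n => e n p.1 * a' n p.2 :=
    Summable.of_norm_bounded hu fun n => h2 n p.1 p.2 hp.2
  have hsum : planeForm (∑' n, e' n p.1 * a n p.2) (∑' n, e n p.1 * a' n p.2) =
      ∑' n, planeForm (e' n p.1 * a n p.2) (e n p.1 * a' n p.2) := by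
    unfold planeForm
    rw [(hs1.smul_const _).tsum_add (hs2.smul_const _), hs1.tsum_smul_const, hs2.tsum_smul_const]
  rw [hsum]
  refine hasFDerivAt_tsum_of_isPreconnected (u := fun n => u n + u n) (hu.add hu)
    (isOpen_univ.prod isOpen_Ioo) (isPreconnected_univ.prod isPreconnected_Ioo)
    (f := fun n p => e n p.1 * a n p.2)
    (f' := fun n p => planeForm (e' n p.1 * a n p.2) (e n p.1 * a' n p.2))
    (fun n z hz => ?_) (fun n z hz => ?_) hp
    (Summable.of_norm_bounded hu fun n => h0 n p.1 p.2 hp.2) hp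
  · have k1 : HasFDerivAt (fun p : ℝ × ℝ => e n p.1) (e' n z.1 • ContinuousLinearMap.fst ℝ ℝ ℝ) z :=
      (he n z.1).comp_hasFDerivAt z hasFDerivAt_fst
    have k2 : HasFDerivAt (fun p : ℝ × ℝ => a n p.2) (a' n z.2 • ContinuousLinearMap.snd ℝ ℝ ℝ) z :=
      (ha n z.2 hz.2).comp_hasFDerivAt z hasFDerivAt_snd
    refine (k1.mul k2).congr_fderiv ?_
    unfold planeForm
    rw [smul_smul, smul_smul, add_comm, mul_comm (a n z.2)]
  · refine (norm_add_le _ _).trans (add_le_add ?_ ?_)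
    · rw [norm_smul]
      exact (mul_le_of_le_one_right (norm_nonneg _) (ContinuousLinearMap.norm_fst_le ..)).trans
        (h1 n z.1 z.2 hz.2)
    · rw [norm_smul]
      exact (mul_le_of_le_one_right (norm_nonneg _) (ContinuousLinearMap.norm_snd_le ..)).trans
        (h2 n z.1 z.2 hz.2)

end SeparatedSeries

/-! ### Separation of variables with data on the top edge -/

/-- The trigonometric term `a cos (n x) + b sin (n x)`. -/
noncomputable def trigTerm (a b : ℝ) (n : ℤ) (x : ℝ) : ℝ :=
  a * Real.cos (n * x) + b * Real.sin (n * x)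

theorem hasDerivAt_trigTerm (a b : ℝ) (n : ℤ) (x : ℝ) :
    HasDerivAt (trigTerm a b n) (trigTerm (n * b) (-(n * a)) n x) x := by
  have hl : HasDerivAt (fun t : ℝ => (n : ℝ) * t) n x := by
    simpa using (hasDerivAt_id x).const_mul (n : ℝ)
  refine ((hl.cos.const_mul a).add (hl.sin.const_mul b)).congr_deriv ?_
  unfold trigTerm
  ring

theorem abs_trigTerm_le (a b : ℝ) (n : ℤ) (x : ℝ) : |trigTerm a b n x| ≤ |a| + |b| := by
  refine (abs_add_le _ _).trans (add_le_add ?_ ?_) <;> rw [abs_mul]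
  · exact mul_le_of_le_one_right (abs_nonneg _) (Real.abs_cos_le_one _)
  · exact mul_le_of_le_one_right (abs_nonneg _) (Real.abs_sin_le_one _)

theorem trigTerm_periodic (a b : ℝ) (n : ℤ) : Function.Periodic (trigTerm a b n) (2 * Real.pi) := by
  intro x
  unfold trigTerm
  rw [mul_add, Real.cos_add_int_mul_two_pi, Real.sin_add_int_mul_two_pi]

/-- Solution of the Dirichlet problem for `Δ - q(y)` with absolutely convergent trigonometric data
on the top boundary. -/
theorem exists_dirichlet_of_summable {κ : ℝ} (hκ0 : 0 ≤ κ) (hκ1 : κ < Real.pi / 2) {q : ℝ → ℝ}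
    (hqc : ContinuousOn q (Set.Icc (-1 : ℝ) 1)) (hq : ∀ y ∈ Set.Icc (-1 : ℝ) 1, -κ ^ 2 < q y)
    {a b : ℤ → ℝ} (hab : Summable fun n => |a n| + |b n|) :
    ∃ φ : ℝ → ℝ → ℝ, IsClassicalOnChannel φ ∧
      (∀ x, ∀ y ∈ Set.Ioo (-1 : ℝ) 1, channelLaplacian φ x y = q y * φ x y) ∧
      (∀ x, φ x 1 = ∑' n, trigTerm (a n) (b n) n x) ∧ ∀ x, φ x (-1) = 0 := by
  have hQ : ∀ n : ℤ, ∀ y ∈ Set.Icc (-1 : ℝ) 1, -κ ^ 2 < (n : ℝ) ^ 2 + q y := fun n y hy => by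
    linarith [hq y hy, sq_nonneg (n : ℝ)]
  have hex : ∀ n : ℤ, ∃ A A' : ℝ → ℝ, IsDirichletProfile (fun y => (n : ℝ) ^ 2 + q y) A A' :=
    fun n => IsDirichletProfile.exists_profile hκ0 hκ1 (continuousOn_const.add hqc) (hQ n)
  choose A A' hA using hex
  set e : ℤ → ℝ → ℝ := fun n => trigTerm (a n) (b n) n with he
  set e' : ℤ → ℝ → ℝ := fun n => trigTerm (n * b n) (-(n * a n)) n with he'
  -- The `-n²` here cancels the `n²` in `A''`, so each term satisfies `Δ = q(y)`.
  set e'' : ℤ → ℝ → ℝ := fun n x => -(n : ℝ) ^ 2 * e n x with he''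
  set A'' : ℤ → ℝ → ℝ := fun n y => ((n : ℝ) ^ 2 + q y) * A n y with hA''
  have hd : ∀ n x, HasDerivAt (e n) (e' n x) x := fun n x => hasDerivAt_trigTerm _ _ n x
  have hd' : ∀ n x, HasDerivAt (e' n) (e'' n x) x := fun n x =>
    (hasDerivAt_trigTerm _ _ n x).congr_deriv (by simp only [he'', he, trigTerm]; ring)
  have hec : ∀ n, Continuous (e n) := fun n =>
    continuous_iff_continuousAt.2 fun x => (hd n x).continuousAt
  have hec' : ∀ n, Continuous (e' n) := fun n =>
    continuous_iff_continuousAt.2 fun x => (hd' n x).continuousAt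
  have hec'' : ∀ n, Continuous (e'' n) := fun n => continuous_const.mul (hec n)
  set S : ℤ → ℝ := fun n => |a n| + |b n| with hS
  have hS0 : ∀ n, 0 ≤ S n := fun n => by positivity
  have hb : ∀ n x, |e n x| ≤ S n := fun n x => abs_trigTerm_le _ _ _ _
  have hb' : ∀ n x, |e' n x| ≤ (1 + |(n : ℝ)|) * S n := fun n x => by
    refine (abs_trigTerm_le _ _ _ _).trans ?_
    rw [abs_neg, abs_mul, abs_mul, hS]
    nlinarith [hS0 n, abs_nonneg (a n), abs_nonneg (b n)]
  have hb'' : ∀ n x, |e'' n x| ≤ (1 + |(n : ℝ)|) ^ 2 * S n := fun n x => by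
    simp only [he'']
    rw [abs_mul, abs_neg, abs_pow]
    refine mul_le_mul ?_ (hb n x) (abs_nonneg _) (by positivity)
    nlinarith [abs_nonneg (n : ℝ)]
  have hAc : ∀ n, ContinuousOn (A n) (Set.Icc (-1 : ℝ) 1) := fun n => (hA n).continuousOn
  set φ : ℝ × ℝ → ℝ := fun p => ∑' n, e n p.1 * A n p.2 with hφ
  set φx : ℝ × ℝ → ℝ := fun p => ∑' n, e' n p.1 * A n p.2 with hφx
  set φy : ℝ × ℝ → ℝ := fun p => ∑' n, e n p.1 * A' n p.2 with hφy
  -- One summable majorant `C (|a n| + |b n|)` serves all products that occur in derivatives up to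
  -- order two.
  have main : ∀ c : ℝ, c < 1 → ∃ u : ℤ → ℝ, Summable u ∧
      ∀ n x, ∀ y ∈ Set.Ioo (-1 : ℝ) c, |e n x * A n y| ≤ u n ∧ |e' n x * A n y| ≤ u n ∧
        |e'' n x * A n y| ≤ u n ∧ |e n x * A' n y| ≤ u n ∧ |e' n x * A' n y| ≤ u n ∧
        |e n x * A'' n y| ≤ u n := by
    intro c hc
    obtain ⟨C, hC⟩ := exists_profile_bounds hκ0 hκ1 hqc hq hA hc
    refine ⟨fun n => C * S n, hab.mul_left C, fun n x y hy => ?_⟩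
    obtain ⟨h1, h2, h3⟩ := hC n y hy
    have hN : 1 ≤ 1 + |(n : ℝ)| := by linarith [abs_nonneg (n : ℝ)]
    set N := 1 + |(n : ℝ)| with hNdef
    have hNN : N ≤ N ^ 2 := by nlinarith
    have key : ∀ s t w B : ℝ, |s| ≤ w * S n → 0 ≤ w → w * |t| ≤ C → |s * t| ≤ C * S n := by
      intro s t w B hs hw ht
      rw [abs_mul]
      calc |s| * |t| ≤ w * S n * |t| := mul_le_mul_of_nonneg_right hs (abs_nonneg _)
        _ = w * |t| * S n := by ring
        _ ≤ C * S n := mul_le_mul_of_nonneg_right ht (hS0 n)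
    have hA0 := abs_nonneg (A n y)
    have hA0' := abs_nonneg (A' n y)
    refine ⟨key _ _ 1 0 (by simpa using hb n x) zero_le_one ?_, key _ _ N 0 (hb' n x) (by linarith) ?_,
      key _ _ (N ^ 2) 0 (hb'' n x) (by positivity) h1,
      key _ _ 1 0 (by simpa using hb n x) zero_le_one ?_, key _ _ N 0 (hb' n x) (by linarith) h2,
      key _ _ 1 0 (by simpa using hb n x) zero_le_one
        (by rw [one_mul]; exact h3)⟩ <;> nlinarith
  have local_facts : ∀ c : ℝ, c < 1 → ContDiffOn ℝ 2 φ (Set.univ ×ˢ Set.Ioo (-1 : ℝ) c) ∧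
      ∀ p ∈ (Set.univ : Set ℝ) ×ˢ Set.Ioo (-1 : ℝ) c,
        HasFDerivAt φ (planeForm (φx p) (φy p)) p ∧
        HasFDerivAt φx (planeForm (∑' n, e'' n p.1 * A n p.2) (∑' n, e' n p.1 * A' n p.2)) p ∧
        HasFDerivAt φy (planeForm (∑' n, e' n p.1 * A' n p.2) (∑' n, e n p.1 * A'' n p.2)) p ∧
        Summable (fun n => e'' n p.1 * A n p.2) ∧ Summable (fun n => e n p.1 * A'' n p.2) := by
    intro c hc
    obtain ⟨u, hu, hall⟩ := main c hc
    have hmem : ∀ y ∈ Set.Ioo (-1 : ℝ) c, y ∈ Set.Ioo (-1 : ℝ) 1 := fun y hy =>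
      ⟨hy.1, hy.2.trans hc⟩
    have hcl : Set.Ioo (-1 : ℝ) c ⊆ Set.Icc (-1) 1 := fun y hy =>
      Set.Ioo_subset_Icc_self (hmem y hy)
    have dA : ∀ n, ∀ y ∈ Set.Ioo (-1 : ℝ) c, HasDerivAt (A n) (A' n y) y := fun n y hy =>
      (hA n).hasDerivAt y (hmem y hy)
    have dA' : ∀ n, ∀ y ∈ Set.Ioo (-1 : ℝ) c, HasDerivAt (A' n) (A'' n y) y := fun n y hy =>
      (hA n).hasDerivAt' y (hmem y hy)
    have cA : ∀ n, ContinuousOn (A n) (Set.Ioo (-1 : ℝ) c) := fun n => (hAc n).mono hcl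
    have cA' : ∀ n, ContinuousOn (A' n) (Set.Ioo (-1 : ℝ) c) := fun n y hy =>
      (dA' n y hy).continuousAt.continuousWithinAt
    have cA'' : ∀ n, ContinuousOn (A'' n) (Set.Ioo (-1 : ℝ) c) := fun n =>
      (continuousOn_const.add (hqc.mono hcl)).mul (cA n)
    have D : ∀ p ∈ (Set.univ : Set ℝ) ×ˢ Set.Ioo (-1 : ℝ) c,
        HasFDerivAt φ (planeForm (φx p) (φy p)) p := fun p hp =>
      hasFDerivAt_tsum_mul hu hd dA (fun n x y hy => (hall n x y hy).1)
        (fun n x y hy => (hall n x y hy).2.1) (fun n x y hy => (hall n x y hy).2.2.2.1) hp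
    have Dx : ∀ p ∈ (Set.univ : Set ℝ) ×ˢ Set.Ioo (-1 : ℝ) c, HasFDerivAt φx
        (planeForm (∑' n, e'' n p.1 * A n p.2) (∑' n, e' n p.1 * A' n p.2)) p := fun p hp =>
      hasFDerivAt_tsum_mul hu hd' dA (fun n x y hy => (hall n x y hy).2.1)
        (fun n x y hy => (hall n x y hy).2.2.1) (fun n x y hy => (hall n x y hy).2.2.2.2.1) hp
    have Dy : ∀ p ∈ (Set.univ : Set ℝ) ×ˢ Set.Ioo (-1 : ℝ) c, HasFDerivAt φy
        (planeForm (∑' n, e' n p.1 * A' n p.2) (∑' n, e n p.1 * A'' n p.2)) p := fun p hp =>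
      hasFDerivAt_tsum_mul hu hd dA' (fun n x y hy => (hall n x y hy).2.2.2.1)
        (fun n x y hy => (hall n x y hy).2.2.2.2.1) (fun n x y hy => (hall n x y hy).2.2.2.2.2) hp
    have hU : IsOpen ((Set.univ : Set ℝ) ×ˢ Set.Ioo (-1 : ℝ) c) := isOpen_univ.prod isOpen_Ioo
    have Cxx := continuousOn_tsum_mul hu hec'' cA fun n x y hy => (hall n x y hy).2.2.1
    have Cxy := continuousOn_tsum_mul hu hec' cA' fun n x y hy => (hall n x y hy).2.2.2.2.1
    have Cyy := continuousOn_tsum_mul hu hec cA'' fun n x y hy => (hall n x y hy).2.2.2.2.2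
    have C1x := contDiffOn_succ_of_partials 0 hU Dx (contDiffOn_zero.2 Cxx) (contDiffOn_zero.2 Cxy)
    have C1y := contDiffOn_succ_of_partials 0 hU Dy (contDiffOn_zero.2 Cxy) (contDiffOn_zero.2 Cyy)
    have C2 := contDiffOn_succ_of_partials 1 hU D (by simpa using C1x) (by simpa using C1y)
    refine ⟨?_, fun p hp => ⟨D p hp, Dx p hp, Dy p hp,
      Summable.of_norm_bounded hu fun n => (hall n p.1 p.2 hp.2).2.2.1,
      Summable.of_norm_bounded hu fun n => (hall n p.1 p.2 hp.2).2.2.2.2.2⟩⟩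
    have h2 : ((1 : ℕ) : WithTop ℕ∞) + 1 = 2 := by norm_num
    rwa [h2] at C2
  have hcos : 0 < Real.cos κ := by simpa using cos_mul_pos hκ0 hκ1 (y := 1) (by norm_num)
  -- Up to `y = 1` the decay is lost, but the uniform bound `1 / cos κ` still gives uniform
  -- convergence.
  have hcont : ContinuousOn φ (Set.univ ×ˢ Set.Icc (-1 : ℝ) 1) := by
    refine continuousOn_tsum_mul (hab.mul_right (1 / Real.cos κ)) hec hAc fun n x y hy => ?_
    rw [abs_mul, abs_of_nonneg ((hA n).nonneg hκ0 hκ1 (hQ n) hy)]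
    exact mul_le_mul (hb n x) ((hA n).le_inv_cos hκ0 hκ1 (hQ n) hy)
      ((hA n).nonneg hκ0 hκ1 (hQ n) hy) (hS0 n)
  -- Interior regularity at height `y` is taken from the strip below the midpoint of `y` and `1`.
  have hmid : ∀ y ∈ Set.Ioo (-1 : ℝ) 1, (y + 1) / 2 < 1 ∧ y ∈ Set.Ioo (-1 : ℝ) ((y + 1) / 2) :=
    fun y hy => ⟨by linarith [hy.2], hy.1, by linarith [hy.2]⟩
  refine ⟨fun x y => φ (x, y), ⟨fun x y _ => ?_, fun p hp => ?_, hcont⟩, fun x y hy => ?_,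
    fun x => ?_, fun x => ?_⟩
  · simp only [hφ]
    refine tsum_congr fun n => ?_
    rw [show e n (x + 2 * Real.pi) = e n x from trigTerm_periodic _ _ n x]
  · obtain ⟨h1, h2⟩ := hmid p.2 hp.2
    exact ((local_facts _ h1).1.contDiffAt
      ((isOpen_univ.prod isOpen_Ioo).mem_nhds ⟨trivial, h2⟩)).contDiffWithinAt
  · obtain ⟨h1, h2⟩ := hmid y hy
    have hloc := (local_facts _ h1).2
    have hxx : iteratedDeriv 2 (fun s => φ (s, y)) x = ∑' n, e'' n x * A n y :=
      iteratedDeriv_two_eq (f' := fun s => φx (s, y))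
        (Filter.Eventually.of_forall fun s =>
          hasDerivAt_left_of_planeForm (hloc (s, y) ⟨trivial, h2⟩).1)
        (hasDerivAt_left_of_planeForm (hloc (x, y) ⟨trivial, h2⟩).2.1)
    have hyy : iteratedDeriv 2 (fun t => φ (x, t)) y = ∑' n, e n x * A'' n y :=
      iteratedDeriv_two_eq (f' := fun t => φy (x, t))
        (by
          filter_upwards [isOpen_Ioo.mem_nhds h2] with t ht using
            hasDerivAt_right_of_planeForm (hloc (x, t) ⟨trivial, ht⟩).1)
        (hasDerivAt_right_of_planeForm (hloc (x, y) ⟨trivial, h2⟩).2.2.1)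
    unfold channelLaplacian
    rw [hxx, hyy, ← (hloc (x, y) ⟨trivial, h2⟩).2.2.2.1.tsum_add
      (hloc (x, y) ⟨trivial, h2⟩).2.2.2.2, hφ]
    simp only
    rw [← tsum_mul_left]
    refine tsum_congr fun n => ?_
    simp only [he'', hA'']
    ring
  · simp only [hφ, (hA _).top, mul_one, he]
  · simp only [hφ, (hA _).bottom, mul_zero, tsum_zero]

/-! ### Absolute convergence of Fourier series -/

theorem norm_fourierCoeffOn_le {a b C : ℝ} (hab : a < b) {f : ℝ → ℂ} (hf : ∀ x, ‖f x‖ ≤ C) (n : ℤ) :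
    ‖fourierCoeffOn hab f n‖ ≤ C := by
  have hba : 0 < b - a := by linarith
  rw [fourierCoeffOn_eq_integral, norm_smul, Real.norm_eq_abs, abs_of_pos (by positivity)]
  have hle : ‖∫ x in a..b, fourier (-n) (x : AddCircle (b - a)) • f x‖ ≤ C * |b - a| := by
    refine intervalIntegral.norm_integral_le_of_norm_le_const fun x _ => ?_
    rw [norm_smul, fourier_apply, Circle.norm_coe, one_mul]
    exact hf x
  rw [abs_of_pos hba] at hle
  calc 1 / (b - a) * _ ≤ 1 / (b - a) * (C * (b - a)) :=
        mul_le_mul_of_nonneg_left hle (by positivity)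
    _ = C := by field_simp

/-- Integration by parts for the Fourier coefficients of a `C¹` function with equal values at the
endpoints. -/
theorem norm_fourierCoeffOn_eq_of_hasDerivAt {a b : ℝ} (hab : a < b) {f f' : ℝ → ℂ}
    (hf : ∀ x, HasDerivAt f (f' x) x) (hf' : Continuous f') (heq : f b = f a) {n : ℤ} (hn : n ≠ 0) :
    ‖fourierCoeffOn hab f n‖ = (b - a) / (2 * Real.pi * |(n : ℝ)|) * ‖fourierCoeffOn hab f' n‖ := by
  have hba : 0 < b - a := by linarith
  rw [fourierCoeffOn_of_hasDerivAt hab hn (fun x _ => hf x) (hf'.intervalIntegrable a b), heq,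
    sub_self, mul_zero, zero_sub]
  have h1 : ‖(b : ℂ) - a‖ = b - a := by
    rw [← Complex.ofReal_sub, Complex.norm_real, Real.norm_eq_abs, abs_of_pos hba]
  rw [norm_mul, norm_neg, norm_mul, h1, norm_div, norm_mul, norm_mul, norm_mul, norm_neg,
    norm_one, Complex.norm_I, Complex.norm_real, Complex.norm_intCast, Real.norm_eq_abs,
    abs_of_pos Real.pi_pos, mul_one]
  rw [RCLike.norm_ofNat]
  ring

/-- The Fourier series of a periodic `C²` function converges absolutely to the function. -/
theorem exists_trigSeries {h : ℝ → ℝ} (hper : Function.Periodic h (2 * Real.pi))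
    (hh : ContDiff ℝ 2 h) :
    ∃ a b : ℤ → ℝ, Summable (fun n => |a n| + |b n|) ∧
      ∀ x, h x = ∑' n, trigTerm (a n) (b n) n x := by
  have hT : Fact (0 < 2 * Real.pi) := ⟨Real.two_pi_pos⟩
  have hab : (0 : ℝ) < 0 + 2 * Real.pi := by linarith [Real.two_pi_pos]
  have hh1 : ContDiff ℝ 1 (deriv h) := by
    have : ContDiff ℝ (1 + 1) h := by
      rw [one_add_one_eq_two]
      exact hh
    exact (contDiff_succ_iff_deriv.1 this).2.2
  have hh2 : Continuous (deriv (deriv h)) := hh1.continuous_deriv le_rfl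
  have d0 : ∀ x, HasDerivAt h (deriv h x) x := fun x =>
    (hh.differentiable (by norm_num) x).hasDerivAt
  have d1 : ∀ x, HasDerivAt (deriv h) (deriv (deriv h) x) x := fun x =>
    (hh1.differentiable (by norm_num) x).hasDerivAt
  have pderiv : ∀ {k : ℝ → ℝ}, Function.Periodic k (2 * Real.pi) →
      Function.Periodic (deriv k) (2 * Real.pi) := by
    intro k hk x
    have h1 : (fun z => k (z + 2 * Real.pi)) = k := funext hk
    rw [← deriv_comp_add_const, h1]
  have p1 := pderiv hper
  have p2 := pderiv p1
  obtain ⟨C, hC⟩ : ∃ C, ∀ x : ℝ, ‖((deriv (deriv h) x : ℝ) : ℂ)‖ ≤ C := by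
    obtain ⟨C, hC⟩ := (p2.compact_of_continuous Real.two_pi_pos.ne' hh2).isBounded.exists_norm_le
    exact ⟨C, fun x => by
      rw [Complex.norm_real]
      exact hC _ ⟨x, rfl⟩⟩
  set f : ℝ → ℂ := fun x => (h x : ℂ) with hf
  have hfc : Continuous f := Complex.continuous_ofReal.comp hh.continuous
  have hf0 : f 0 = f (0 + 2 * Real.pi) := by simp only [hf, hper 0]
  let G : C(AddCircle (2 * Real.pi), ℂ) :=
    ⟨AddCircle.liftIco (2 * Real.pi) 0 f, AddCircle.liftIco_continuous hf0 hfc.continuousOn⟩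
  have hG : ∀ x : ℝ, G (x : AddCircle (2 * Real.pi)) = f x := by
    intro x
    have hp : Function.Periodic (fun t : ℝ => ((t : AddCircle (2 * Real.pi)), f t))
        (2 * Real.pi) := fun t => by
      simp only [hf, hper t, AddCircle.coe_add_period]
    obtain ⟨z, hz, he⟩ := hp.exists_mem_Ico₀ Real.two_pi_pos x
    obtain ⟨h1, h2⟩ := Prod.mk.inj he
    rw [h1, h2]
    change AddCircle.liftIco (2 * Real.pi) 0 f (z : AddCircle (2 * Real.pi)) = f z
    exact AddCircle.liftIco_coe_apply (a := 0)
      (show z ∈ Set.Ico 0 (0 + 2 * Real.pi) by rwa [zero_add])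
  have hcoef : ∀ n, fourierCoeff G n = fourierCoeffOn hab f n := fun n =>
    fourierCoeff_liftIco_eq f n
  -- Two integrations by parts, each gaining a factor `1 / |n|`.
  have hbound : ∀ n : ℤ, n ≠ 0 → ‖fourierCoeff G n‖ ≤ C * (1 / (n : ℝ) ^ 2) := by
    intro n hn
    have hnpos : 0 < |(n : ℝ)| := by positivity
    have e1 := norm_fourierCoeffOn_eq_of_hasDerivAt hab (f := f) (f' := fun x => ((deriv h x : ℝ) : ℂ))
      (fun x => (d0 x).ofReal_comp) (Complex.continuous_ofReal.comp hh1.continuous) hf0.symm hn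
    have e2 := norm_fourierCoeffOn_eq_of_hasDerivAt hab (f := fun x => ((deriv h x : ℝ) : ℂ))
      (f' := fun x => ((deriv (deriv h) x : ℝ) : ℂ)) (fun x => (d1 x).ofReal_comp)
      (Complex.continuous_ofReal.comp hh2) (by simp only [p1 0]) hn
    have hpi := Real.pi_pos
    have hr : (0 + 2 * Real.pi - 0) / (2 * Real.pi * |(n : ℝ)|) = 1 / |(n : ℝ)| := by
      field_simp
      ring
    rw [hcoef, e1, e2, hr, ← mul_assoc, ← sq_abs]
    have := norm_fourierCoeffOn_le hab hC n
    calc _ ≤ 1 / |(n : ℝ)| * (1 / |(n : ℝ)|) * C := mul_le_mul_of_nonneg_left this (by positivity)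
      _ = _ := by ring
  have hsum : Summable (fourierCoeff G) := by
    refine Summable.of_norm_bounded_eventually
      (((Real.summable_one_div_int_pow (p := 2)).2 (by norm_num)).mul_left C) ?_
    refine Set.Finite.subset (Set.finite_singleton (0 : ℤ)) fun n hn => ?_
    by_contra hne
    exact hn (hbound n hne)
  -- As `h` is real, take real parts: `Re (c exp (i n x)) = Re c cos (n x) - Im c sin (n x)`.
  refine ⟨fun n => (fourierCoeff G n).re, fun n => -(fourierCoeff G n).im, ?_, fun x => ?_⟩
  · refine Summable.of_nonneg_of_le (fun n => by positivity) (fun n => ?_)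
      (hsum.norm.add hsum.norm)
    rw [abs_neg]
    exact add_le_add (Complex.abs_re_le_norm _) (Complex.abs_im_le_norm _)
  · have hs := has_pointwise_sum_fourier_series_of_summable hsum (x : AddCircle (2 * Real.pi))
    rw [hG x] at hs
    have hre := (Complex.hasSum_re hs).tsum_eq
    simp only [hf, Complex.ofReal_re] at hre
    rw [← hre]
    refine tsum_congr fun n => ?_
    have harg : 2 * (Real.pi : ℂ) * Complex.I * n * x / (2 * Real.pi : ℝ) =
        ((n * x : ℝ) : ℂ) * Complex.I := by
      have : (Real.pi : ℂ) ≠ 0 := by exact_mod_cast Real.pi_pos.ne'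
      push_cast
      field_simp
    rw [fourier_coe_apply, harg, smul_eq_mul, Complex.mul_re, Complex.exp_ofReal_mul_I_re,
      Complex.exp_ofReal_mul_I_im, trigTerm]
    ring

/-! ### The Dirichlet problem with data on both edges -/

/-- Reflection `y ↦ -y` of a function on the channel. -/
theorem IsClassicalOnChannel.reflect {u : ℝ → ℝ → ℝ} (hu : IsClassicalOnChannel u) :
    IsClassicalOnChannel (fun x y => u x (-y)) := by
  refine ⟨fun x y hy => hu.periodic x (-y) ⟨by linarith [hy.2], by linarith [hy.1]⟩, ?_, ?_⟩
  · exact hu.contDiffOn.comp (g := Function.uncurry u) (f := fun p : ℝ × ℝ => (p.1, -p.2))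
      (by fun_prop) fun p hp => ⟨trivial, by linarith [hp.2.2], by linarith [hp.2.1]⟩
  · exact hu.continuousOn.comp (g := Function.uncurry u) (f := fun p : ℝ × ℝ => (p.1, -p.2))
      (by fun_prop) fun p hp => ⟨trivial, by linarith [hp.2.2], by linarith [hp.2.1]⟩

theorem channelLaplacian_reflect (u : ℝ → ℝ → ℝ) (x y : ℝ) :
    channelLaplacian (fun x y => u x (-y)) x y = channelLaplacian u x (-y) := by
  unfold channelLaplacian
  rw [iteratedDeriv_comp_neg 2 (fun t => u x t)]
  simp

/-- Classical solvability of `Δφ = q(y) φ` in the channel with periodic `C²` boundary values. -/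
theorem exists_dirichlet {κ : ℝ} (hκ0 : 0 ≤ κ) (hκ1 : κ < Real.pi / 2) {q : ℝ → ℝ}
    (hqc : ContinuousOn q (Set.Icc (-1 : ℝ) 1)) (hq : ∀ y ∈ Set.Icc (-1 : ℝ) 1, -κ ^ 2 < q y)
    {g h : ℝ → ℝ} (hgp : Function.Periodic g (2 * Real.pi)) (hg : ContDiff ℝ 2 g)
    (hhp : Function.Periodic h (2 * Real.pi)) (hh : ContDiff ℝ 2 h) :
    ∃ φ : ℝ → ℝ → ℝ, IsClassicalOnChannel φ ∧
      (∀ x, ∀ y ∈ Set.Ioo (-1 : ℝ) 1, channelLaplacian φ x y = q y * φ x y) ∧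
      (∀ x, φ x 1 = h x) ∧ ∀ x, φ x (-1) = g x := by
  have hneg : ∀ y ∈ Set.Icc (-1 : ℝ) 1, -y ∈ Set.Icc (-1 : ℝ) 1 := fun y hy =>
    ⟨by linarith [hy.2], by linarith [hy.1]⟩
  obtain ⟨a, b, hab, hsum⟩ := exists_trigSeries hhp hh
  obtain ⟨a', b', hab', hsum'⟩ := exists_trigSeries hgp hg
  obtain ⟨φ, hφ, hφe, hφt, hφb⟩ := exists_dirichlet_of_summable hκ0 hκ1 hqc hq hab
  -- Bottom data become top data for the reflected coefficient `q (-y)`.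
  obtain ⟨χ, hχ, hχe, hχt, hχb⟩ := exists_dirichlet_of_summable hκ0 hκ1
    (q := fun y => q (-y)) (hqc.comp continuousOn_neg hneg) (fun y hy => hq _ (hneg y hy)) hab'
  refine ⟨fun x y => φ x y + χ x (-y), hφ.add hχ.reflect, fun x y hy => ?_, fun x => ?_,
    fun x => ?_⟩
  · rw [hφ.laplacian_add hχ.reflect x hy, channelLaplacian_reflect, hφe x y hy,
      hχe x (-y) ⟨by linarith [hy.2], by linarith [hy.1]⟩]
    simp only [neg_neg]
    ring
  · beta_reduce
    rw [hφt, hχb, add_zero, hsum]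
  · beta_reduce
    rw [hφb, neg_neg, hχt, zero_add, hsum']

/-- A-priori bound by the boundary values. -/
theorem IsClassicalOnChannel.abs_le_of_boundary {u : ℝ → ℝ → ℝ} (hu : IsClassicalOnChannel u) {κ D : ℝ}
    (hκ0 : 0 ≤ κ) (hκ1 : κ < Real.pi / 2) {q : ℝ → ℝ → ℝ}
    (hq : ∀ x, ∀ y ∈ Set.Ioo (-1 : ℝ) 1, -κ ^ 2 < q x y)
    (heq : ∀ x, ∀ y ∈ Set.Ioo (-1 : ℝ) 1, channelLaplacian u x y = q x y * u x y)
    (htop : ∀ x, |u x 1| ≤ D) (hbot : ∀ x, |u x (-1)| ≤ D) :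
    ∀ x, ∀ y ∈ Set.Icc (-1 : ℝ) 1, |u x y| ≤ D / Real.cos κ := by
  have hcos : 0 < Real.cos κ := by simpa using cos_mul_pos hκ0 hκ1 (y := 1) (by norm_num)
  have hD : 0 ≤ D := (abs_nonneg _).trans (htop 0)
  set K := D / Real.cos κ with hK
  have hK0 : 0 ≤ K := div_nonneg hD hcos.le
  have hKD : K * Real.cos κ = D := div_mul_cancel₀ _ hcos.ne'
  -- The barrier `K cos (κ y)` equals `D` on both edges and dominates `u` and `-u`.
  have hθ := (isClassicalOnChannel_cos κ).const_mul K
  have one_side : ∀ v : ℝ → ℝ → ℝ, IsClassicalOnChannel v →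
      (∀ x, ∀ y ∈ Set.Ioo (-1 : ℝ) 1, channelLaplacian v x y = q x y * v x y) →
      (∀ x, |v x 1| ≤ D) → (∀ x, |v x (-1)| ≤ D) →
      ∀ x, ∀ y ∈ Set.Icc (-1 : ℝ) 1, v x y ≤ K := by
    intro v hv hve hvt hvb x y hy
    have h := (hθ.sub hv).nonneg hκ0 hκ1
      (fun x => by
        rw [mul_one, hKD]
        linarith [le_abs_self (v x 1), hvt x])
      (fun x => by
        rw [mul_neg_one, Real.cos_neg, hKD]
        linarith [le_abs_self (v x (-1)), hvb x])
      (fun x y hy hneg => by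
        rw [hθ.laplacian_sub hv x hy, IsClassicalOnChannel.laplacian_const_mul,
          channelLaplacian_cos, hve x y hy]
        have h1 : 0 ≤ K * Real.cos (κ * y) :=
          mul_nonneg hK0 (cos_mul_pos hκ0 hκ1 (Set.Ioo_subset_Icc_self hy)).le
        nlinarith [hq x y hy]) x y hy
    have h2 : K * Real.cos (κ * y) ≤ K := mul_le_of_le_one_right hK0 (Real.cos_le_one _)
    linarith
  intro x y hy
  refine abs_le.2 ⟨?_, one_side u hu heq htop hbot x y hy⟩
  have := one_side (fun x y => -1 * u x y) (hu.const_mul (-1))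
    (fun x y hy => by
      rw [IsClassicalOnChannel.laplacian_const_mul, heq x y hy]
      ring) (fun x => by simpa using htop x) (fun x => by simpa using hbot x) x y hy
  linarith

/-! ### Structure of the stream function -/

/-- The point `ξ` is kept in `[-R, R]`, where the lower bound `-κ²` on `F'` is available. -/
theorem exists_mean_value {F : ℝ → ℝ} (hF : Differentiable ℝ F) {R a b : ℝ} (ha : |a| ≤ R)
    (hb : |b| ≤ R) : ∃ ξ, |ξ| ≤ R ∧ F a - F b = deriv F ξ * (a - b) := by
  wlog h : b ≤ a generalizing a b
  · obtain ⟨ξ, h1, h2⟩ := this hb ha (le_of_not_ge h)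
    exact ⟨ξ, h1, by linarith⟩
  rcases h.eq_or_lt with rfl | h
  · exact ⟨b, hb, by ring⟩
  obtain ⟨ξ, hξ, he⟩ := exists_deriv_eq_slope F h hF.continuous.continuousOn hF.differentiableOn
  refine ⟨ξ, abs_le.2 ⟨(abs_le.1 hb).1.trans hξ.1.le, hξ.2.le.trans (abs_le.1 ha).2⟩, ?_⟩
  rw [he, div_mul_cancel₀ _ (by linarith)]

theorem IsClassicalOnChannel.translate {u : ℝ → ℝ → ℝ} (hu : IsClassicalOnChannel u) (s : ℝ) :
    IsClassicalOnChannel (fun x y => u (x + s) y) := by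
  refine ⟨fun x y hy => by rw [add_right_comm, hu.periodic _ y hy], ?_, ?_⟩
  · exact hu.contDiffOn.comp (g := Function.uncurry u) (f := fun p : ℝ × ℝ => (p.1 + s, p.2))
      (by fun_prop) fun p hp => ⟨trivial, hp.2⟩
  · exact hu.continuousOn.comp (g := Function.uncurry u) (f := fun p : ℝ × ℝ => (p.1 + s, p.2))
      (by fun_prop) fun p hp => ⟨trivial, hp.2⟩

theorem channelLaplacian_translate (u : ℝ → ℝ → ℝ) (s x y : ℝ) :
    channelLaplacian (fun x y => u (x + s) y) x y = channelLaplacian u (x + s) y := by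
  unfold channelLaplacian
  rw [iteratedDeriv_comp_add_const 2 (fun z => u z y) s]

theorem IsClassicalOnChannel.exists_abs_le {u : ℝ → ℝ → ℝ} (hu : IsClassicalOnChannel u) :
    ∃ R, ∀ x, ∀ y ∈ Set.Icc (-1 : ℝ) 1, |u x y| ≤ R := by
  obtain ⟨R, hR⟩ := (isCompact_Icc.prod isCompact_Icc).exists_bound_of_continuousOn
    (hu.continuousOn.mono (Set.prod_mono (Set.subset_univ (Set.Icc 0 (2 * Real.pi))) subset_rfl))
  refine ⟨R, fun x y hy => ?_⟩
  have hp : Function.Periodic (fun s => u s y) (2 * Real.pi) := fun s => hu.periodic s y hy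
  obtain ⟨x', hx', he⟩ := hp.exists_mem_Ico₀ Real.two_pi_pos x
  have he' : u x y = u x' y := he
  rw [he']
  exact hR (x', y) ⟨Set.Ico_subset_Icc_self hx', hy⟩

namespace IsSteadyStreamFunction

variable {F : ℝ → ℝ} {cg ch : ℝ} {ψ : ℝ → ℝ → ℝ}

theorem classical (hψ : IsSteadyStreamFunction F cg ch ψ) : IsClassicalOnChannel ψ :=
  ⟨hψ.periodic, hψ.contDiffOn.mono (Set.prod_mono subset_rfl Set.Ioo_subset_Icc_self),
    hψ.contDiffOn.continuousOn⟩

/-- Stream functions with slope of `F` above `-κ²` depend on `y` only. -/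
theorem apply_eq_apply_zero (hψ : IsSteadyStreamFunction F cg ch ψ) (hF : Differentiable ℝ F) {κ R : ℝ}
    (hκ0 : 0 ≤ κ) (hκ1 : κ < Real.pi / 2) (hR : ∀ x, ∀ y ∈ Set.Icc (-1 : ℝ) 1, |ψ x y| ≤ R)
    (hlt : ∀ s, |s| ≤ R → -κ ^ 2 < deriv F s) (x : ℝ) {y : ℝ} (hy : y ∈ Set.Icc (-1 : ℝ) 1) :
    ψ x y = ψ 0 y := by
  -- The difference of a translate and `ψ` solves a linear equation with coefficient `F'(ξ)`. The
  -- maximum principle asks for no regularity of it, so `ξ` may be chosen pointwise.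
  have hex : ∀ z t : ℝ, ∃ ξ, t ∈ Set.Icc (-1 : ℝ) 1 →
      |ξ| ≤ R ∧ F (ψ (z + x) t) - F (ψ z t) = deriv F ξ * (ψ (z + x) t - ψ z t) := by
    intro z t
    by_cases ht : t ∈ Set.Icc (-1 : ℝ) 1
    · obtain ⟨ξ, hξ⟩ := exists_mean_value hF (hR (z + x) t ht) (hR z t ht)
      exact ⟨ξ, fun _ => hξ⟩
    · exact ⟨0, fun h => absurd h ht⟩
  choose ξ hξ using hex
  have hcl := hψ.classical
  have h := ((hcl.translate x).sub hcl).eq_zero hκ0 hκ1 (q := fun z t => deriv F (ξ z t))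
    (fun z t ht => hlt _ (hξ z t (Set.Ioo_subset_Icc_self ht)).1)
    (fun z t ht => by
      rw [(hcl.translate x).laplacian_sub hcl z ht, channelLaplacian_translate,
        hψ.equation _ t ht, hψ.equation _ t ht]
      exact (hξ z t (Set.Ioo_subset_Icc_self ht)).2)
    (fun z => by rw [hψ.top, hψ.top, sub_self]) (fun z => by rw [hψ.bottom, hψ.bottom, sub_self])
    0 y hy
  rw [zero_add] at h
  linarith

theorem verticalDeriv_eq (hind : ∀ x, ∀ y ∈ Set.Icc (-1 : ℝ) 1, ψ x y = ψ 0 y) (x : ℝ) {y : ℝ}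
    (hy : y ∈ Set.Icc (-1 : ℝ) 1) : verticalDeriv ψ x y = verticalDeriv ψ 0 y :=
  derivWithin_congr (fun t ht => hind x t ht) (hind x y hy)

/-- The vertical derivative cannot vanish on both boundary components. -/
theorem verticalDeriv_ne_zero (hψ : IsSteadyStreamFunction F cg ch ψ) (hc : ch ≠ cg)
    (hF : Differentiable ℝ F) {κ : ℝ} (hκ0 : 0 ≤ κ) (hκ1 : κ < Real.pi / 2)
    (hind : ∀ x, ∀ y ∈ Set.Icc (-1 : ℝ) 1, ψ x y = ψ 0 y)
    (hlt : ∀ y ∈ Set.Icc (-1 : ℝ) 1, -κ ^ 2 < deriv F (ψ 0 y)) :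
    verticalDeriv ψ 0 1 ≠ 0 ∨ verticalDeriv ψ 0 (-1) ≠ 0 := by
  by_contra! hcon
  obtain ⟨h1, h2⟩ := hcon
  set f : ℝ → ℝ := fun y => ψ 0 y with hf
  set v : ℝ → ℝ := verticalDeriv ψ 0 with hv
  have hfC : ContDiffOn ℝ 2 f (Set.Icc (-1 : ℝ) 1) :=
    hψ.contDiffOn.comp (g := Function.uncurry ψ) (f := fun t : ℝ => ((0 : ℝ), t)) (by fun_prop)
      fun t ht => ⟨trivial, ht⟩
  have hvc : ContinuousOn v (Set.Icc (-1 : ℝ) 1) :=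
    hfC.continuousOn_derivWithin (uniqueDiffOn_Icc (by norm_num)) (by norm_num)
  have hvd : ∀ y ∈ Set.Ioo (-1 : ℝ) 1, v y = deriv f y := fun y hy =>
    derivWithin_of_mem_nhds (Icc_mem_nhds hy.1 hy.2)
  have hfd : ∀ y ∈ Set.Ioo (-1 : ℝ) 1, HasDerivAt f (v y) y := fun y hy => by
    rw [hvd y hy]
    exact (contDiffAt_two_hasDerivAt (hψ.classical.contDiffAt_right 0 hy)).1
  -- The equation gives `v' = F(f)`, which is differentiable; thus `v'' = F'(f) v` holds although
  -- `ψ` is only `C²`.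
  have hvd' : ∀ y ∈ Set.Ioo (-1 : ℝ) 1, HasDerivAt v (F (f y)) y := fun y hy => by
    have h := (contDiffAt_two_hasDerivAt (hψ.classical.contDiffAt_right 0 hy)).2
    have he := hψ.equation 0 y hy
    have hconst : (fun s => ψ s y) = fun _ => ψ 0 y :=
      funext fun s => hind s y (Set.Ioo_subset_Icc_self hy)
    have hz : iteratedDeriv 2 (fun s => ψ s y) 0 = 0 := by
      rw [hconst]
      simp [iteratedDeriv_const]
    rw [channelLaplacian, hz, zero_add] at he
    rw [he] at h
    refine h.congr_of_eventuallyEq ?_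
    filter_upwards [isOpen_Ioo.mem_nhds hy] with t ht using hvd t ht
  have hvd'' : ∀ y ∈ Set.Ioo (-1 : ℝ) 1,
      HasDerivAt (fun t => F (f t)) (deriv F (f y) * v y) y := fun y hy =>
    (hF (f y)).hasDerivAt.comp y (hfd y hy)
  have hp := nonneg_of_second_deriv_lt hκ0 hκ1 hvc hvd' hvd'' h1.ge h2.ge fun y hy h =>
    mul_lt_mul_of_neg_right (hlt y (Set.Ioo_subset_Icc_self hy)) h
  have hn := nonneg_of_second_deriv_lt hκ0 hκ1 hvc.neg (fun y hy => (hvd' y hy).neg)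
    (fun y hy => (hvd'' y hy).neg) (by simp [h1]) (by simp [h2]) fun y hy h => by
      simp only [Pi.neg_apply] at h ⊢
      nlinarith [hlt y (Set.Ioo_subset_Icc_self hy)]
  -- Since `v` vanishes inside, its mean `(ch - cg) / 2` is zero, a contradiction.
  obtain ⟨ξ, hξ, he⟩ := exists_hasDerivAt_eq_slope f v (by norm_num : (-1 : ℝ) < 1)
    hfC.continuousOn hfd
  have hξ0 : v ξ = 0 := le_antisymm (by simpa using hn ξ (Set.Ioo_subset_Icc_self hξ))
    (hp ξ (Set.Ioo_subset_Icc_self hξ))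
  rw [hξ0, hf] at he
  simp only [hψ.top, hψ.bottom] at he
  refine hc ?_
  norm_num at he
  linarith

end IsSteadyStreamFunction

/-! ### A solution that varies on every interior horizontal line -/

theorem ContDiffOn.two_of_hasDerivAt {s : Set ℝ} (hs : IsOpen s) {f f' f'' : ℝ → ℝ}
    (hf : ∀ y ∈ s, HasDerivAt f (f' y) y) (hf' : ∀ y ∈ s, HasDerivAt f' (f'' y) y)
    (hc : ContinuousOn f'' s) : ContDiffOn ℝ 2 f s := by
  have one : ContDiffOn ℝ (0 + 1) f' s := by
    rw [contDiffOn_succ_iff_deriv_of_isOpen hs]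
    refine ⟨fun y hy => (hf' y hy).differentiableAt.differentiableWithinAt, by simp, ?_⟩
    exact contDiffOn_zero.2 (hc.congr fun y hy => (hf' y hy).deriv)
  rw [← one_add_one_eq_two, contDiffOn_succ_iff_deriv_of_isOpen hs]
  refine ⟨fun y hy => (hf y hy).differentiableAt.differentiableWithinAt, by simp, ?_⟩
  rw [zero_add] at one
  exact one.congr fun y hy => (hf y hy).deriv

/-- The separated solution with data `cos x` on the top boundary; it is not constant on any
interior horizontal line. -/
theorem exists_cos_solution {κ : ℝ} (hκ0 : 0 ≤ κ) (hκ1 : κ < Real.pi / 2) {q : ℝ → ℝ}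
    (hqc : ContinuousOn q (Set.Icc (-1 : ℝ) 1)) (hq : ∀ y ∈ Set.Icc (-1 : ℝ) 1, -κ ^ 2 < q y) :
    ∃ φ : ℝ → ℝ → ℝ, IsClassicalOnChannel φ ∧
      (∀ x, ∀ y ∈ Set.Ioo (-1 : ℝ) 1, channelLaplacian φ x y = q y * φ x y) ∧
      (∀ x, φ x 1 = Real.cos x) ∧ (∀ x, φ x (-1) = 0) ∧
      ∀ y ∈ Set.Ioo (-1 : ℝ) 1, φ 0 y ≠ φ Real.pi y := by
  -- The coefficient `1 + q` belongs to frequency one: the solution is `A(y) cos x`, whose values at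
  -- `0` and `π` differ by `2 A(y) > 0`.
  have hQ : ∀ y ∈ Set.Icc (-1 : ℝ) 1, -κ ^ 2 < 1 + q y := fun y hy => by linarith [hq y hy]
  have hQc : ContinuousOn (fun y => 1 + q y) (Set.Icc (-1 : ℝ) 1) := continuousOn_const.add hqc
  obtain ⟨A, A', hA⟩ := IsDirichletProfile.exists_profile hκ0 hκ1 hQc hQ
  have hAC : ContDiffOn ℝ 2 A (Set.Ioo (-1 : ℝ) 1) :=
    ContDiffOn.two_of_hasDerivAt isOpen_Ioo hA.hasDerivAt hA.hasDerivAt'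
      ((hQc.mul hA.continuousOn).mono Set.Ioo_subset_Icc_self)
  refine ⟨fun x y => A y * Real.cos x, ⟨fun x y _ => by rw [Real.cos_add_two_pi], ?_, ?_⟩,
    fun x y hy => ?_, fun x => by simp [hA.top], fun x => by simp [hA.bottom],
    fun y hy => ?_⟩
  · exact (hAC.comp contDiffOn_snd fun p hp => hp.2).mul
      (Real.contDiff_cos.comp contDiff_fst).contDiffOn
  · exact (hA.continuousOn.comp continuousOn_snd fun p hp => hp.2).mul
      (Real.continuous_cos.comp continuous_fst).continuousOn
  · have hxx : iteratedDeriv 2 (fun s => A y * Real.cos s) x = A y * -Real.cos x :=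
      iteratedDeriv_two_eq (f' := fun s => A y * -Real.sin s)
        (Filter.Eventually.of_forall fun s => (Real.hasDerivAt_cos s).const_mul _)
        ((Real.hasDerivAt_sin x).neg.const_mul _)
    have hyy : iteratedDeriv 2 (fun t => A t * Real.cos x) y = (1 + q y) * A y * Real.cos x :=
      iteratedDeriv_two_eq (f' := fun t => A' t * Real.cos x)
        (by
          filter_upwards [isOpen_Ioo.mem_nhds hy] with t ht using
            (hA.hasDerivAt t ht).mul_const _)
        ((hA.hasDerivAt' y hy).mul_const _)
    rw [channelLaplacian, hxx, hyy]
    ring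
  · have := hA.pos hκ0 hκ1 hQc hQ hy
    simp only [Real.cos_zero, Real.cos_pi]
    intro h
    linarith

/-! ### The Hölder space and the difference functional -/

namespace PeriodicC2Holder

variable {α : ℝ≥0}

theorem abs_apply_le_norm (u : PeriodicC2Holder α) (x : ℝ) : |u x| ≤ ‖u‖ := by
  have h0 := le_ciSup (u.bddAbove_range (i := 0) (by simp)) x
  have h1 := Finset.single_le_sum (f := fun i => ⨆ x : ℝ, |iteratedDeriv i u x|)
    (fun i _ => Real.iSup_nonneg fun x => abs_nonneg _) (show 0 ∈ Finset.range 3 by simp)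
  rw [norm_def]
  simp only [iteratedDeriv_zero] at h0 h1
  have h2 : (0 : ℝ) ≤ nnHolderNorm α (iteratedDeriv 2 u) := NNReal.coe_nonneg _
  linarith

/-- The cosine as an element of `C^{2,α}(𝕋)`. -/
noncomputable def cosine (α : ℝ≥0) (hα : α ≤ 1) : PeriodicC2Holder α :=
  (⟨Real.cos, Real.cos_periodic, Real.contDiff_cos, by
    have h2 : iteratedDeriv 2 Real.cos = fun x => -Real.cos x := by
      funext x
      exact iteratedDeriv_two_eq (Filter.Eventually.of_forall Real.hasDerivAt_cos)
        (Real.hasDerivAt_sin x).neg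
    rw [h2]
    -- Exponent `α` is interpolated between boundedness (exponent `0`) and the Lipschitz bound
    -- (exponent `1`).
    have h0 : MemHolder 0 fun x => -Real.cos x := by
      refine ⟨2, fun x y => ?_⟩
      rw [NNReal.coe_zero, ENNReal.rpow_zero, mul_one, edist_dist, Real.dist_eq]
      refine ENNReal.ofReal_le_of_le_toReal ?_
      have h1 := abs_le.1 (Real.abs_cos_le_one x)
      have h2 := abs_le.1 (Real.abs_cos_le_one y)
      rw [ENNReal.coe_toReal, NNReal.coe_ofNat, abs_le]
      constructor <;> linarith
    have h1 : MemHolder 1 fun x => -Real.cos x := ⟨1, Real.lipschitzWith_cos.neg.holderWith⟩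
    exact h0.memHolder_of_le_of_le h1 zero_le hα⟩ : periodicC2HolderSubmodule α)

theorem cosine_apply (hα : α ≤ 1) (x : ℝ) : cosine α hα x = Real.cos x := rfl

theorem add_apply (u v : PeriodicC2Holder α) (x : ℝ) :
    (u + v : PeriodicC2Holder α) x = u x + v x := rfl

theorem smul_apply (c : ℝ) (u : PeriodicC2Holder α) (x : ℝ) :
    (c • u : PeriodicC2Holder α) x = c * u x := rfl

theorem zero_apply (x : ℝ) : (0 : PeriodicC2Holder α) x = 0 := rfl

end PeriodicC2Holder

/-- A nonzero continuous linear functional is nonzero on an open dense set. -/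
theorem ContinuousLinearMap.dense_ne_zero {E : Type*} [NormedAddCommGroup E] [NormedSpace ℝ E]
    (T : E →L[ℝ] ℝ) {p : E} (hp : T p ≠ 0) : Dense {x | T x ≠ 0} := by
  have h : {x | T x ≠ 0} = ((LinearMap.ker T.toLinearMap : Submodule ℝ E) : Set E)ᶜ := by
    ext x
    simp
  rw [h, ← interior_eq_empty_iff_dense_compl]
  by_contra hne
  -- A subspace with nonempty interior is the whole space.
  have htop := Submodule.eq_top_of_nonempty_interior' (LinearMap.ker T.toLinearMap)
    (Set.nonempty_iff_ne_empty.2 hne)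
  exact hp (by simpa using (htop ▸ Submodule.mem_top : p ∈ LinearMap.ker T.toLinearMap))

/-- The unique solvability of the Dirichlet problem for `Δ - q(y)` gives the solution operator,
evaluated at two points of a horizontal line, as a continuous linear functional of the data. -/
theorem exists_difference_functional {α : ℝ≥0} {κ : ℝ} (hκ0 : 0 ≤ κ) (hκ1 : κ < Real.pi / 2)
    {q : ℝ → ℝ} (hqc : ContinuousOn q (Set.Icc (-1 : ℝ) 1))
    (hq : ∀ y ∈ Set.Icc (-1 : ℝ) 1, -κ ^ 2 < q y) (V W : ℝ) {y₀ : ℝ}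
    (hy₀ : y₀ ∈ Set.Icc (-1 : ℝ) 1) (x x' : ℝ) :
    ∃ T : (PeriodicC2Holder α × PeriodicC2Holder α) →L[ℝ] ℝ,
      ∀ p : PeriodicC2Holder α × PeriodicC2Holder α, ∀ φ : ℝ → ℝ → ℝ, IsClassicalOnChannel φ →
        (∀ x, ∀ y ∈ Set.Ioo (-1 : ℝ) 1, channelLaplacian φ x y = q y * φ x y) →
        (∀ x, φ x 1 = p.2 x * V) → (∀ x, φ x (-1) = p.1 x * W) →
        T p = φ x y₀ - φ x' y₀ := by
  have hq' : ∀ x : ℝ, ∀ y ∈ Set.Ioo (-1 : ℝ) 1, -κ ^ 2 < q y := fun _ y hy =>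
    hq y (Set.Ioo_subset_Icc_self hy)
  have hex : ∀ p : PeriodicC2Holder α × PeriodicC2Holder α, ∃ φ : ℝ → ℝ → ℝ,
      IsClassicalOnChannel φ ∧
      (∀ x, ∀ y ∈ Set.Ioo (-1 : ℝ) 1, channelLaplacian φ x y = q y * φ x y) ∧
      (∀ x, φ x 1 = p.2 x * V) ∧ ∀ x, φ x (-1) = p.1 x * W := fun p =>
    exists_dirichlet hκ0 hκ1 hqc hq
      (g := fun x => p.1 x * W) (h := fun x => p.2 x * V)
      (fun x => congrArg (· * W) (p.1.periodic x)) (p.1.contDiff.mul contDiff_const)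
      (fun x => congrArg (· * V) (p.2.periodic x)) (p.2.contDiff.mul contDiff_const)
  -- The solutions are chosen arbitrarily; uniqueness makes the choice linear in the data, and the
  -- sup bound makes it continuous.
  choose S hS hSe hSt hSb using hex
  have huniq : ∀ p : PeriodicC2Holder α × PeriodicC2Holder α, ∀ φ : ℝ → ℝ → ℝ,
      IsClassicalOnChannel φ →
      (∀ x, ∀ y ∈ Set.Ioo (-1 : ℝ) 1, channelLaplacian φ x y = q y * φ x y) →
      (∀ x, φ x 1 = p.2 x * V) → (∀ x, φ x (-1) = p.1 x * W) → ∀ x, S p x y₀ = φ x y₀ := by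
    intro p φ hφ he ht hb x
    have h := ((hS p).sub hφ).eq_zero hκ0 hκ1 hq'
      (fun x y hy => by
        rw [(hS p).laplacian_sub hφ x hy, hSe p x y hy, he x y hy]
        ring)
      (fun x => by rw [hSt, ht, sub_self]) (fun x => by rw [hSb, hb, sub_self]) x y₀ hy₀
    linarith
  have hadd : ∀ p p', ∀ x, S (p + p') x y₀ = S p x y₀ + S p' x y₀ := fun p p' x =>
    huniq (p + p') (fun x y => S p x y + S p' x y) ((hS p).add (hS p'))
      (fun x y hy => by
        rw [(hS p).laplacian_add (hS p') x hy, hSe p x y hy, hSe p' x y hy]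
        ring)
      (fun x => by
        rw [hSt, hSt, Prod.snd_add, PeriodicC2Holder.add_apply]
        ring)
      (fun x => by
        rw [hSb, hSb, Prod.fst_add, PeriodicC2Holder.add_apply]
        ring) x
  have hsmul : ∀ (c : ℝ) p, ∀ x, S (c • p) x y₀ = c * S p x y₀ := fun c p x =>
    huniq (c • p) (fun x y => c * S p x y) ((hS p).const_mul c)
      (fun x y hy => by
        rw [IsClassicalOnChannel.laplacian_const_mul, hSe p x y hy]
        ring)
      (fun x => by
        rw [hSt, Prod.smul_snd, PeriodicC2Holder.smul_apply]
        ring)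
      (fun x => by
        rw [hSb, Prod.smul_fst, PeriodicC2Holder.smul_apply]
        ring) x
  have hbound : ∀ p, ∀ x, |S p x y₀| ≤ (|V| + |W|) / Real.cos κ * ‖p‖ := by
    intro p x
    have h := (hS p).abs_le_of_boundary (D := (|V| + |W|) * ‖p‖) hκ0 hκ1 hq' (hSe p)
      (fun x => by
        rw [hSt, abs_mul, mul_comm]
        exact mul_le_mul (by linarith [abs_nonneg W])
          ((p.2.abs_apply_le_norm x).trans (norm_snd_le p)) (abs_nonneg _) (by positivity))
      (fun x => by
        rw [hSb, abs_mul, mul_comm]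
        exact mul_le_mul (by linarith [abs_nonneg V])
          ((p.1.abs_apply_le_norm x).trans (norm_fst_le p)) (abs_nonneg _) (by positivity)) x y₀ hy₀
    rwa [mul_div_right_comm] at h
  let T₀ : (PeriodicC2Holder α × PeriodicC2Holder α) →ₗ[ℝ] ℝ :=
    { toFun := fun p => S p x y₀ - S p x' y₀
      map_add' := fun p p' => by
        rw [hadd, hadd]
        ring
      map_smul' := fun c p => by
        rw [hsmul, hsmul, RingHom.id_apply, smul_eq_mul]
        ring }
  refine ⟨T₀.mkContinuous (2 * ((|V| + |W|) / Real.cos κ)) fun p => ?_, fun p φ h1 h2 h3 h4 => ?_⟩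
  · refine (abs_sub _ _).trans ?_
    linarith [hbound p x, hbound p x']
  · change S p x y₀ - S p x' y₀ = _
    rw [huniq p φ h1 h2 h3 h4, huniq p φ h1 h2 h3 h4]

/-! ### The open dense set of boundary data -/

theorem lemma3p3 (α : ℝ≥0) (hα0 : 0 < α) (hα1 : α < 1)
    (F : ℝ → ℝ) (hF : ContDiff ℝ 4 F) (hF' : ∀ s : ℝ, -firstDirichletEigenvalue < deriv F s)
    (cg ch : ℝ) (hc : ch ≠ cg)
    (ψ₀ : ℝ → ℝ → ℝ) (hψ₀ : IsSteadyStreamFunction F cg ch ψ₀)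
    (x₀ y₀ : ℝ) (hy₀ : y₀ ∈ Set.Ioo (-1 : ℝ) 1) (hstag : IsStagnationPoint ψ₀ x₀ y₀) :
    ∃ B : Set (PeriodicC2Holder α × PeriodicC2Holder α), IsOpen B ∧ Dense B ∧
      ∀ p ∈ B, ∃ φ : ℝ → ℝ → ℝ, IsLinearizedSolution F ψ₀ p.1 p.2 φ ∧
        (∀ φ' : ℝ → ℝ → ℝ, IsLinearizedSolution F ψ₀ p.1 p.2 φ' →
          ∀ x : ℝ, ∀ y ∈ Set.Icc (-1 : ℝ) 1, φ' x y = φ x y) ∧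
        ∃ x x' : ℝ, φ x y₀ ≠ φ x' y₀ := by
  have hFd : Differentiable ℝ F := hF.differentiable (by norm_num)
  have hFc : Continuous (deriv F) := hF.continuous_deriv (by norm_num)
  obtain ⟨R, hR⟩ := hψ₀.classical.exists_abs_le
  obtain ⟨κ, hκ0, hκ1, hκ⟩ := exists_kappa hFc hF' R
  have hind : ∀ x, ∀ y ∈ Set.Icc (-1 : ℝ) 1, ψ₀ x y = ψ₀ 0 y := fun x y hy =>
    hψ₀.apply_eq_apply_zero hFd hκ0 hκ1 hR hκ x hy
  set q : ℝ → ℝ := fun y => deriv F (ψ₀ 0 y)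
  have hq : ∀ y ∈ Set.Icc (-1 : ℝ) 1, -κ ^ 2 < q y := fun y hy => hκ _ (hR 0 y hy)
  have hqc : ContinuousOn q (Set.Icc (-1 : ℝ) 1) :=
    hFc.comp_continuousOn (hψ₀.contDiffOn.continuousOn.comp (g := Function.uncurry ψ₀)
      (f := fun t : ℝ => ((0 : ℝ), t)) (by fun_prop) fun t ht => ⟨trivial, ht⟩)
  have hVW := hψ₀.verticalDeriv_ne_zero hc hFd hκ0 hκ1 hind hq
  set V := verticalDeriv ψ₀ 0 1 with hV
  set W := verticalDeriv ψ₀ 0 (-1) with hW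
  have hV' : ∀ x, verticalDeriv ψ₀ x 1 = V := fun x =>
    IsSteadyStreamFunction.verticalDeriv_eq hind x (by norm_num)
  have hW' : ∀ x, verticalDeriv ψ₀ x (-1) = W := fun x =>
    IsSteadyStreamFunction.verticalDeriv_eq hind x (by norm_num)
  have heq : ∀ {g h : ℝ → ℝ} {φ : ℝ → ℝ → ℝ}, IsLinearizedSolution F ψ₀ g h φ →
      ∀ x, ∀ y ∈ Set.Ioo (-1 : ℝ) 1, channelLaplacian φ x y = q y * φ x y :=
    fun hφ x y hy => by
      have h := hφ.equation x y hy
      rw [hind x y (Set.Ioo_subset_Icc_self hy)] at h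
      exact sub_eq_zero.1 h
  -- The points `0` and `π` are those that `cos x` separates; `-V` carries the sign of the top
  -- boundary condition.
  obtain ⟨T, hT⟩ := exists_difference_functional (α := α) hκ0 hκ1 hqc hq (-V) W
    (Set.Ioo_subset_Icc_self hy₀) 0 Real.pi
  have hne : ∃ p, T p ≠ 0 := by
    rcases hVW with h | h
    · obtain ⟨φ, hφ, he, ht, hb, hφne⟩ := exists_cos_solution hκ0 hκ1 hqc hq
      refine ⟨(0, PeriodicC2Holder.cosine α hα1.le), ?_⟩
      rw [hT _ (fun x y => -V * φ x y) (hφ.const_mul _)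
        (fun x y hy => by
          rw [IsClassicalOnChannel.laplacian_const_mul, he x y hy]
          ring)
        (fun x => by rw [ht, PeriodicC2Holder.cosine_apply, mul_comm])
        (fun x => by rw [hb, PeriodicC2Holder.zero_apply, mul_zero, zero_mul]), ← mul_sub]
      exact mul_ne_zero (neg_ne_zero.2 h) (sub_ne_zero.2 (hφne y₀ hy₀))
    -- When `W ≠ 0`, the cosine sits on the bottom edge, and the reflected separated solution is
    -- read off at height `-y₀`.
    · have hneg : ∀ y ∈ Set.Icc (-1 : ℝ) 1, -y ∈ Set.Icc (-1 : ℝ) 1 := fun y hy =>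
        ⟨by linarith [hy.2], by linarith [hy.1]⟩
      obtain ⟨φ, hφ, he, ht, hb, hφne⟩ := exists_cos_solution hκ0 hκ1 (q := fun y => q (-y))
        (hqc.comp continuousOn_neg hneg) fun y hy => hq _ (hneg y hy)
      refine ⟨(PeriodicC2Holder.cosine α hα1.le, 0), ?_⟩
      rw [hT _ (fun x y => W * φ x (-y)) (hφ.reflect.const_mul _)
        (fun x y hy => by
          rw [IsClassicalOnChannel.laplacian_const_mul, channelLaplacian_reflect,
            he x (-y) ⟨by linarith [hy.2], by linarith [hy.1]⟩, neg_neg]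
          ring)
        (fun x => by rw [hb, PeriodicC2Holder.zero_apply, mul_zero, zero_mul])
        (fun x => by rw [neg_neg, ht, PeriodicC2Holder.cosine_apply, mul_comm]), ← mul_sub]
      exact mul_ne_zero h (sub_ne_zero.2 (hφne (-y₀) ⟨by linarith [hy₀.2], by linarith [hy₀.1]⟩))
  obtain ⟨p₁, hp₁⟩ := hne
  refine ⟨{p | T p ≠ 0}, isOpen_ne_fun T.continuous continuous_const, T.dense_ne_zero hp₁,
    fun p hp => ?_⟩
  obtain ⟨φ, hφ, he, ht, hb⟩ := exists_dirichlet hκ0 hκ1 hqc hq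
    (g := fun x => p.1 x * W) (h := fun x => -p.2 x * V)
    (fun x => congrArg (· * W) (p.1.periodic x)) (p.1.contDiff.mul contDiff_const)
    (fun x => congrArg (-· * V) (p.2.periodic x)) (p.2.contDiff.neg.mul contDiff_const)
  have hsol : IsLinearizedSolution F ψ₀ p.1 p.2 φ := by
    refine ⟨hφ, fun x y hy => ?_, fun x => ?_, fun x => ?_⟩
    · rw [he x y hy, hind x y (Set.Ioo_subset_Icc_self hy), sub_self]
    · rw [ht, hV']
    · rw [hb, hW']
  refine ⟨φ, hsol, fun φ' hφ' x y hy => ?_, 0, Real.pi, fun hcon => hp ?_⟩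
  · have h := (hφ'.classical.sub hφ).eq_zero hκ0 hκ1 (q := fun _ => q)
      (fun _ y hy => hq y (Set.Ioo_subset_Icc_self hy))
      (fun x y hy => by
        rw [hφ'.classical.laplacian_sub hφ x hy, heq hφ' x y hy, he x y hy]
        ring)
      (fun x => by rw [hφ'.top, hsol.top, sub_self])
      (fun x => by rw [hφ'.bottom, hsol.bottom, sub_self]) x y hy
    linarith
  · rw [hT p φ hφ he (fun x => by rw [ht]; ring) hb, hcon, sub_self]
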